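/- **Model.** There are $n$ single-server queues with infinite buffers, in discrete time. In slot $t$ a number $A(t)\in\mathbb{N}$ of jobs arrives, and all of them are sent to one queue. The server of queue $l$ then offers $S_l(t)\in\mathbb{N}$ potential services. The sequences $(A(t))_{t\ge0}$ and $(\mathbf S(t))_{t\ge0}$ are each i.i.d. and are independent of each other, with $E[A(t)]=n\lambda$, $E[S_l(t)]=\mu_l>0$, and almost surely $A(t)\le nA_{\max}$ and $S_l(t)\le S_{\max}$. The services offered by different servers in one slot may be dependent. The queue lengths satisfy $\mathbf Q(t+1)=[\mathbf Q(t)+A(t)\mathbf Z(t)-\mathbf S(t)]^+$, where $\mathbf Z(t)\in\{e_1,\dots,e_n\}$ indicates the queue to which the arrivals are sent. **Policies.** A policy in $\Pi$ is given by a positive integer $T$, a vector $\boldsymbol\gamma\in(0,\infty)^n$, a measurable sorting function $L:\mathbb{R}_+^n\times[0,1]\to\mathcal S_n$ such that $\eta=L(\mathbf o,v)$ always satisfies $o_{\eta(1)}\ge\dots\ge o_{\eta(n)}$, and a measurable decision function $Y:\mathcal S_n\times(0,\infty)^n\times[0,1]\to\{e_1,\dots,e_n\}^T$. Let $(V_k)_{k\ge0}$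 and $(W_k)_{k\ge0}$ be i.i.d. uniform on $[0,1]$, such that $\mathbf Q(0)$, all $A(t)$, all $\mathbf S(t)$, all $V_k$ and all $W_k$ are independent. At time $kT$ the policy computes $\mathbf O(kT)=(Q_l(kT)/\gamma_l)_l$, $\eta_k=L(\mathbf O(kT),V_k)$ and $\phi(k)=Y(\eta_k,\boldsymbol\mu,W_k)$. In slot $t$ it uses $\mathbf Z(t)=\phi_{t-\lfloor t/T\rfloor T+1}(\lfloor t/T\rfloor)$, where $\phi_j(k)$ is the $j$-th entry of $\phi(k)$. For a permutation $\eta$ and $l\in[n]$ let $$f_{l,\eta}=\frac1T\,E\Big[\#\{j\in[T]:\ Y(\eta,\boldsymbol\mu,W)_j=e_{\eta(l)}\}\Big],\qquad W\sim\mathrm{Unif}[0,1],$$ which is the expected fraction of the slots of a cycle in which arrivals are sent to the $l$-th longest scaled queue, given that $\eta_k=\eta$. **Theorem.** For every policy in $\Pi$, if $$n\lambda<\min_{\eta\in\mathcal S_n}\ \min_{m\in[n]}\ \frac{\sum_{l=1}^m\mu_{\eta(l)}}{\sum_{l=1}^m f_{l,\eta}}$$ (a ratio with zero denominator being $+\infty$),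 then $\mathbf X(t)=\big(\mathbf Q(t),\ \phi(\lfloor t/T\rfloor),\ t-\lfloor t/T\rfloor T\big)$, $t\ge0$, is a positive recurrent time-homogeneous Markov chain on $\mathbb{N}^n\times\{e_1,\dots,e_n\}^T\times\{0,\dots,T-1\}$. Here a chain on a countable state space that need not be irreducible is called positive recurrent if every state of every closed communicating class has finite mean return time and, from every initial state, the expected time to reach the set of states with finite mean return time is finite. In particular, if the chain is irreducible, then every state has finite mean return time. -/

import Mathlib

open MeasureTheory ProbabilityTheory Filter
open scoped NNReal ENNReal unitInterval

noncomputable section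

namespace LoadBalancing

/-! ### Markov chains on a countable state space -/

section MarkovChain

variable {S : Type*} [MeasurableSpace S]

/-- `X` is a time-homogeneous Markov chain with transition kernel `κ` (countable state space):
`P(X 0 = h 0, …, X t = h t, X (t+1) = y) = P(X 0 = h 0, …, X t = h t) * κ (h t) {y}`. -/
def IsMarkovChain {Ω : Type*} [MeasurableSpace Ω] (P : Measure Ω) (X : ℕ → Ω → S)
    (κ : Kernel S S) : Prop :=
  (∀ t, Measurable (X t)) ∧
  ∀ (t : ℕ) (h : ℕ → S) (y : S),
    P {ω | (∀ s ≤ t, X s ω = h s) ∧ X (t + 1) ω = y} =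
      P {ω | ∀ s ≤ t, X s ω = h s} * κ (h t) {y}

/-- The law, on the space of trajectories, of the Markov chain with transition kernel `κ`
started at `x`. -/
def pathLaw (κ : Kernel S S) [IsMarkovKernel κ] (x : S) : Measure (ℕ → S) :=
  Kernel.traj (X := fun _ => S)
    (fun n => κ.comap (fun h : (i : Finset.Iic n) → S => h ⟨n, Finset.mem_Iic.2 le_rfl⟩)
      (measurable_pi_apply _)) 0 (fun _ => x)

/-- The first time `t ≥ m` at which the trajectory `ω` is in `B` (`∞` if there is none). -/
def entranceTime (m : ℕ) (B : Set S) (ω : ℕ → S) : ℝ≥0∞ :=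
  ⨅ (t : ℕ) (_ : m ≤ t ∧ ω t ∈ B), (t : ℝ≥0∞)

/-- The mean return time `E_x[inf {t ≥ 1 : X t = x}]`. -/
def meanReturnTime (κ : Kernel S S) [IsMarkovKernel κ] (x : S) : ℝ≥0∞ :=
  ∫⁻ ω, entranceTime 1 {x} ω ∂(pathLaw κ x)

/-- The mean hitting time `E_x[inf {t ≥ 0 : X t ∈ B}]`. -/
def meanHittingTime (κ : Kernel S S) [IsMarkovKernel κ] (x : S) (B : Set S) : ℝ≥0∞ :=
  ∫⁻ ω, entranceTime 0 B ω ∂(pathLaw κ x)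

/-- The state `x` is positive recurrent. -/
def IsPosRecState (κ : Kernel S S) [IsMarkovKernel κ] (x : S) : Prop :=
  meanReturnTime κ x < ∞

/-- `y` can be reached from `x` in zero or more transitions of positive probability. -/
def Reaches (κ : Kernel S S) : S → S → Prop :=
  Relation.ReflTransGen fun x y => 0 < κ x {y}

/-- `C` is a closed communicating class. The chain is irreducible iff `Set.univ` is one. -/
def IsClosedClass (κ : Kernel S S) (C : Set S) : Prop :=
  C.Nonempty ∧ ∀ x ∈ C, ∀ y, Reaches κ x y ↔ y ∈ C

/-- Positive recurrence of a (possibly reducible) chain on a countable state space: every state of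
every closed communicating class is positive recurrent, and from every state the set of positive
recurrent states is reached in finite mean time. For an irreducible chain this says that
every state is positive recurrent. -/
def PositiveRecurrent (κ : Kernel S S) [IsMarkovKernel κ] : Prop :=
  (∀ C, IsClosedClass κ C → ∀ x ∈ C, IsPosRecState κ x) ∧
  ∀ x, meanHittingTime κ x {y | IsPosRecState κ y} < ∞

end MarkovChain

/-! ### The policies -/

/-- A policy of the framework for `n` servers. A unit vector `e_i` is represented by its index `i`,
so a decision vector is a function `Fin T → Fin n`. -/
structure Policy (n : ℕ) where
  /-- the length of the dispatching cycle -/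
  T : ℕ
  T_pos : 0 < T
  /-- the scaling vector -/
  γ : Fin n → ℝ≥0
  γ_pos : ∀ l, 0 < γ l
  /-- the sorting function, applied to a scaled queue length vector and a random seed -/
  L : (Fin n → ℝ≥0) → I → Equiv.Perm (Fin n)
  measurableSet_L : ∀ o η, MeasurableSet {v | L o v = η}
  L_sorted : ∀ (o : Fin n → ℝ≥0) (v : I), Antitone fun l => o (L o v l)
  /-- the decision function, applied to a permutation, the service rates and a random seed -/
  Y : Equiv.Perm (Fin n) → (Fin n → {r : ℝ // 0 < r}) → I → Fin T → Fin n
  measurableSet_Y : ∀ η μ d, MeasurableSet {w | Y η μ w = d}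

namespace Policy

variable {n : ℕ} (pol : Policy n) (μ : Fin n → {r : ℝ // 0 < r})

/-- The scaled queue length vector `O = (Q_l / γ_l)_l`. -/
def scaled (q : Fin n → ℕ) : Fin n → ℝ≥0 := fun l => (q l : ℝ≥0) / pol.γ l

/-- The decision vector chosen when the sampled queue lengths are `q` and the seeds are `v`, `w`. -/
def decision (q : Fin n → ℕ) (v w : I) : Fin pol.T → Fin n :=
  pol.Y (pol.L (pol.scaled q) v) μ w

/-- The number `N_η(l)` of slots of a cycle in which arrivals are sent to server `η l`, when the
permutation is `η` and the decision seed is `w`. -/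
def count (η : Equiv.Perm (Fin n)) (l : Fin n) (w : I) : ℕ :=
  (Finset.univ.filter fun j : Fin pol.T => pol.Y η μ w j = η l).card

/-- The mean fraction `f_{l,η}` of slots in which arrivals are sent to the `l`-th longest scaled
queue, given that the permutation is `η` (the decision seed is uniform and independent of `η`). -/
def frac (l : Fin n) (η : Equiv.Perm (Fin n)) : ℝ :=
  ∫ w : I, (pol.count μ η l w : ℝ) / (pol.T : ℝ)

/-! ### The Markov chain -/

/-- States (queue lengths, current decision vector, position in the dispatching cycle). -/
abbrev State : Type := (Fin n → ℕ) × (Fin pol.T → Fin n) × Fin pol.T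

/-- Queue lengths after one slot: `[q + a e_i - s]^+` (the subtraction of `ℕ` is truncated). -/
def nextQueue (q : Fin n → ℕ) (i : Fin n) (a : ℕ) (s : Fin n → ℕ) : Fin n → ℕ :=
  fun l => q l + (if l = i then a else 0) - s l

/-- One step from state `x`, with `u = ((a, s), (v, w))`: `a` arrivals, potential services `s`, and
seeds `v`, `w`, which are used only if a new cycle starts. -/
def step (x : pol.State) (u : (ℕ × (Fin n → ℕ)) × (I × I)) : pol.State :=
  if h : (x.2.2 : ℕ) + 1 < pol.T then
    (nextQueue x.1 (x.2.1 x.2.2) u.1.1 u.1.2, x.2.1, ⟨x.2.2 + 1, h⟩)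
  else
    (nextQueue x.1 (x.2.1 x.2.2) u.1.1 u.1.2,
      pol.decision μ (nextQueue x.1 (x.2.1 x.2.2) u.1.1 u.1.2) u.2.1 u.2.2, ⟨0, pol.T_pos⟩)

lemma measurable_decision (q : Fin n → ℕ) :
    Measurable fun u : I × I => pol.decision μ q u.1 u.2 := by
  refine measurable_to_countable' fun d => ?_
  have : (fun u : I × I => pol.decision μ q u.1 u.2) ⁻¹' {d} =
      ⋃ η, {v | pol.L (pol.scaled q) v = η} ×ˢ {w | pol.Y η μ w = d} := by
    ext u
    simp [decision]
  rw [this]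
  exact MeasurableSet.iUnion fun η =>
    (pol.measurableSet_L _ η).prod (pol.measurableSet_Y η μ d)

lemma measurable_step (x : pol.State) : Measurable (pol.step μ x) := by
  refine measurable_from_prod_countable_right fun as => ?_
  by_cases h : (x.2.2 : ℕ) + 1 < pol.T
  · simp only [step, dif_pos h]
    exact measurable_const
  · simp only [step, dif_neg h]
    exact measurable_const.prodMk ((pol.measurable_decision μ _).prodMk measurable_const)

/-- The transition kernel of the chain, when `α` is the law of the number of arrivals in a slot and
`ς` is the law of the vector of potential services in a slot. -/
def chainKernel (α : Measure ℕ) (ς : Measure (Fin n → ℕ)) : Kernel pol.State pol.State :=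
  ⟨fun x => ((α.prod ς).prod ((volume : Measure I).prod (volume : Measure I))).map (pol.step μ x),
    Measurable.of_discrete⟩

instance (α : Measure ℕ) [IsProbabilityMeasure α] (ς : Measure (Fin n → ℕ))
    [IsProbabilityMeasure ς] : IsMarkovKernel (pol.chainKernel μ α ς) :=
  ⟨fun x => Measure.isProbabilityMeasure_map (pol.measurable_step μ x).aemeasurable⟩

end Policy

/-! ### The queueing system -/

/-- Indices of the random inputs of the system: the initial queue lengths, the arrivals and
potential services of each slot, and the seeds of each dispatching cycle. -/
inductive Input where
  | queue
  | arrival (t : ℕ)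
  | service (t : ℕ)
  | sortSeed (k : ℕ)
  | decisionSeed (k : ℕ)

section System

variable {n : ℕ} {Ω : Type*} [MeasurableSpace Ω]

/-- The σ-algebra generated by each random input. -/
@[reducible] def inputAlgebra (Q₀ : Ω → Fin n → ℕ) (A : ℕ → Ω → ℕ) (S : ℕ → Ω → Fin n → ℕ)
    (V W : ℕ → Ω → I) : Input → MeasurableSpace Ω
  | .queue => MeasurableSpace.comap Q₀ inferInstance
  | .arrival t => MeasurableSpace.comap (A t) inferInstance
  | .service t => MeasurableSpace.comap (S t) inferInstance
  | .sortSeed k => MeasurableSpace.comap (V k) inferInstance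
  | .decisionSeed k => MeasurableSpace.comap (W k) inferInstance

/-- The decision vector `φ(k)` of the `k`-th cycle. -/
def cycleDecision (pol : Policy n) (μ : Fin n → {r : ℝ // 0 < r}) (Q : ℕ → Ω → Fin n → ℕ)
    (V W : ℕ → Ω → I) (k : ℕ) (ω : Ω) : Fin pol.T → Fin n :=
  pol.decision μ (Q (k * pol.T) ω) (V k ω) (W k ω)

/-- The position `t - ⌊t / T⌋ T` of slot `t` in its cycle. -/
def cyclePos (pol : Policy n) (t : ℕ) : Fin pol.T := ⟨t % pol.T, Nat.mod_lt t pol.T_pos⟩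

/-- The chain `X(t) = (Q(t), φ(⌊t / T⌋), t - ⌊t / T⌋ T)`. -/
def chain (pol : Policy n) (μ : Fin n → {r : ℝ // 0 < r}) (Q : ℕ → Ω → Fin n → ℕ)
    (V W : ℕ → Ω → I) (t : ℕ) (ω : Ω) : pol.State :=
  (Q t ω, cycleDecision pol μ Q V W (t / pol.T) ω, cyclePos pol t)

/-- `Q` is the queue length sequence of the system with arrivals `A`, potential services `S` and
seeds `V`, `W`, under the policy `pol`. -/
structure IsQueueingSystem (P : Measure Ω) (pol : Policy n) (μ : Fin n → {r : ℝ // 0 < r})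
    (α : Measure ℕ) (ς : Measure (Fin n → ℕ)) (A : ℕ → Ω → ℕ) (S : ℕ → Ω → Fin n → ℕ)
    (V W : ℕ → Ω → I) (Q : ℕ → Ω → Fin n → ℕ) : Prop where
  measurable_init : Measurable (Q 0)
  measurable_A : ∀ t, Measurable (A t)
  measurable_S : ∀ t, Measurable (S t)
  measurable_V : ∀ k, Measurable (V k)
  measurable_W : ∀ k, Measurable (W k)
  law_A : ∀ t, P.map (A t) = α
  law_S : ∀ t, P.map (S t) = ς
  law_V : ∀ k, P.map (V k) = volume
  law_W : ∀ k, P.map (W k) = volume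
  /-- all random inputs are independent (the services in one slot may be dependent across
  servers) -/
  indep : iIndep (inputAlgebra (Q 0) A S V W) P
  /-- `Q(t+1) = [Q(t) + A(t) Z(t) - S(t)]^+`, where `Z(t)` is the current entry of the decision
  vector of the current cycle -/
  dynamics : ∀ t ω, Q (t + 1) ω = Policy.nextQueue (Q t ω)
    (cycleDecision pol μ Q V W (t / pol.T) ω (cyclePos pol t)) (A t ω) (S t ω)

end System

end LoadBalancing

end

/-! The stability condition says that, for every ordering η and every m, the m longest scaled queues
together have negative mean drift over a cycle, uniformly by some δ > 0, since there are finitely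
many pairs (η, m) (`exists_partialSums_le`). Summation by parts against the decreasing scaled
lengths turns this into negative drift in the direction of the scaled queue vector
(`sum_mul_le_neg_sum`, `integral_sum_scaled_mul_shift_le`).

This holds only on average over a cycle: in a single slot Σ Q_l² / γ_l may have positive drift. The
Lyapunov function is therefore Σ (Q_l + c_l)² / γ_l, where c_l (`shift`) is the net change of queue
l still expected in the current cycle, ignoring truncation at 0, minus ε = δ/n per elapsed slot.
Inside a cycle Q_l + c_l then loses ε per slot in mean. At the end of a cycle c_l has become -εT and
is replaced by the expected net change over the next cycle; weighted by the scaled queues, the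
latter averages to at most -εT Σ Q_l / γ_l, so the replacement costs only a constant. This gives the
one-step drift bound C - 2ε Σ Q_l / γ_l (`lyapunov_drift`), which is at most -1 off a finite set.

The Foster–Lyapunov criterion is proved without irreducibility (`positiveRecurrent_of_drift`). A
bounded perturbation moves the exceptional set from a finite set F to any set B reachable from all
of F (`exists_drift_off`), and every state reaches a closed class, because it reaches F and F is
finite. The Markov property holds because each transition is a fixed function of the current state
and of inputs independent of the past. -/

namespace LoadBalancing

/-! ### Trajectory measures and bounds on mean entrance times. -/

section PathLaw

set_option linter.unusedSectionVars false

variable {S : Type*} [MeasurableSpace S] (κ : Kernel S S) [IsMarkovKernel κ]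

instance (x : S) : IsProbabilityMeasure (pathLaw κ x) := by
  unfold pathLaw; infer_instance

/-- The Markov property of the trajectory law in integrated form: the joint law of the history up to
`b` and the next state is the law of the history composed with the kernel. -/
lemma lintegral_pathLaw_succ (x : S) (b : ℕ) {g : ((i : Finset.Iic b) → S) → ℝ≥0∞}
    (hg : Measurable g) {v : S → ℝ≥0∞} (hv : Measurable v) :
    ∫⁻ ω, g (Preorder.frestrictLe b ω) * v (ω (b + 1)) ∂(pathLaw κ x) =
      ∫⁻ ω, g (Preorder.frestrictLe b ω) * ∫⁻ y, v y ∂(κ (ω b)) ∂(pathLaw κ x) := by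
  set η : (n : ℕ) → Kernel ((i : Finset.Iic n) → S) S :=
    fun n => κ.comap (fun h : (i : Finset.Iic n) → S => h ⟨n, Finset.mem_Iic.2 le_rfl⟩)
      (measurable_pi_apply _) with hη
  have key := Kernel.partialTraj_compProd_eq_map_traj (X := fun _ => S) (κ := η)
    (Nat.zero_le b) (x₀ := fun _ => x)
  have hm : Measurable fun p : ((i : Finset.Iic b) → S) × S => g p.1 * v p.2 := by fun_prop
  have h1 : ∫⁻ ω, g (Preorder.frestrictLe b ω) * v (ω (b + 1)) ∂(pathLaw κ x) =
      ∫⁻ p, g p.1 * v p.2 ∂((Kernel.traj (X := fun _ => S) η 0 (fun _ => x)).map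
        (fun x ↦ (Preorder.frestrictLe b x, x (b + 1)))) := by
    rw [lintegral_map hm (by fun_prop)]
    rfl
  have hm2 : Measurable fun h : (i : Finset.Iic b) → S =>
      g h * ∫⁻ y, v y ∂(κ (h ⟨b, Finset.mem_Iic.2 le_rfl⟩)) := by
    have := hv.lintegral_kernel (κ := κ)
    fun_prop
  rw [h1, ← key, Measure.lintegral_compProd hm, ← Kernel.traj_map_frestrictLe_apply]
  have h2 : ∀ a : (i : Finset.Iic b) → S, ∫⁻ y, g a * v y ∂(η b a) =
      g a * ∫⁻ y, v y ∂(κ (a ⟨b, Finset.mem_Iic.2 le_rfl⟩)) := by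
    intro a
    rw [lintegral_const_mul _ hv]
    rfl
  simp_rw [h2]
  rw [lintegral_map hm2 (by fun_prop)]
  rfl

lemma pathLaw_start [MeasurableSingletonClass S] (x : S) :
    ∀ᵐ ω ∂(pathLaw κ x), ω 0 = x := by
  set η : (n : ℕ) → Kernel ((i : Finset.Iic n) → S) S :=
    fun n => κ.comap (fun h : (i : Finset.Iic n) → S => h ⟨n, Finset.mem_Iic.2 le_rfl⟩)
      (measurable_pi_apply _) with hη
  have h := Kernel.traj_map_frestrictLe_apply (X := fun _ => S) (κ := η) 0 0 (fun _ => x)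
  rw [Kernel.partialTraj_self, Kernel.id_apply] at h
  have h3 : ∀ᵐ a ∂((Kernel.traj (X := fun _ => S) η 0 (fun _ => x)).map
      (Preorder.frestrictLe 0)), a ⟨0, Finset.mem_Iic.2 le_rfl⟩ = x := by
    rw [h, ae_dirac_iff]
    exact (measurable_pi_apply (X := fun _ : Finset.Iic 0 => S) ⟨0, Finset.mem_Iic.2 le_rfl⟩)
      (measurableSet_singleton x)
  exact ae_of_ae_map (by fun_prop) h3

/-- Tail-sum formula for τ - m. Only this inequality is needed, so measurability of the entrance
time never enters. -/
lemma entranceTime_le_tsum (m : ℕ) (B : Set S) (ω : ℕ → S) :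
    entranceTime m B ω ≤ m + ∑' i : ℕ,
      {ω : ℕ → S | ∀ t, m ≤ t → t < m + i + 1 → ω t ∉ B}.indicator (fun _ => (1 : ℝ≥0∞)) ω := by
  by_cases h : ∃ t, m ≤ t ∧ ω t ∈ B
  · classical
    let t := Nat.find h
    have ht : m ≤ t ∧ ω t ∈ B := Nat.find_spec h
    have hle : entranceTime m B ω ≤ t := iInf₂_le t ht
    refine hle.trans ?_
    have : (t : ℝ≥0∞) = m + ∑ i ∈ Finset.range (t - m), (1 : ℝ≥0∞) := by
      rw [Finset.sum_const, Finset.card_range, nsmul_eq_mul, mul_one, ← Nat.cast_add,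
        Nat.add_sub_cancel' ht.1]
    rw [this]
    gcongr
    refine le_trans (Finset.sum_le_sum fun i hi => ?_) (ENNReal.sum_le_tsum (Finset.range (t - m)))
    rw [Set.indicator_of_mem]
    intro s hs hs' hB
    have := Nat.find_min' h ⟨hs, hB⟩
    have hi' := Finset.mem_range.1 hi
    change t ≤ s at this
    omega
  · push Not at h
    have : ∀ i : ℕ, {ω : ℕ → S | ∀ t, m ≤ t → t < m + i + 1 → ω t ∉ B}.indicator
        (fun _ => (1 : ℝ≥0∞)) ω = 1 := by
      intro i
      rw [Set.indicator_of_mem]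
      exact fun t ht _ => h t ht
    simp_rw [this]
    rw [ENNReal.tsum_const_eq_top_of_ne_zero one_ne_zero]
    simp

/-- Comparison principle: a nonnegative function whose drift is at most `-1` off `B` bounds the
mean entrance time into `B`. -/
lemma lintegral_entranceTime_le [DiscreteMeasurableSpace S] (x : S) (m : ℕ) (B : Set S)
    {v : S → ℝ≥0∞} (hv : ∀ y ∉ B, (∫⁻ z, v z ∂(κ y)) + 1 ≤ v y) :
    ∫⁻ ω, entranceTime m B ω ∂(pathLaw κ x) ≤ m + ∫⁻ ω, v (ω m) ∂(pathLaw κ x) := by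
  have hvm : Measurable v := Measurable.of_discrete
  have hκm : Measurable fun y => ∫⁻ z, v z ∂(κ y) := Measurable.of_discrete
  -- With the strict bound `t < k`, `A (k + 1)` depends only on coordinates up to `k`, and `A m` is
  -- the whole space.
  let A : ℕ → Set (ℕ → S) := fun k => {ω | ∀ t, m ≤ t → t < k → ω t ∉ B}
  let A' : (k : ℕ) → Set ((i : Finset.Iic k) → S) :=
    fun k => {h | ∀ t : Finset.Iic k, m ≤ t → h t ∉ B}
  have hA'm : ∀ k, MeasurableSet (A' k) := by
    intro k
    have : A' k = ⋂ t : Finset.Iic k, ⋂ (_ : m ≤ t), (fun h => h t) ⁻¹' Bᶜ := by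
      ext h; simp [A']
    rw [this]
    exact MeasurableSet.iInter fun t => MeasurableSet.iInter fun _ =>
      (measurable_pi_apply t) MeasurableSet.of_discrete
  have hAA' : ∀ k, A (k + 1) = Preorder.frestrictLe k ⁻¹' A' k := by
    intro k
    ext ω
    simp only [A, A', Set.mem_ofPred_eq, Set.mem_preimage, Subtype.forall, Finset.mem_Iic,
      Preorder.frestrictLe_apply, Nat.lt_succ_iff]
    exact ⟨fun h t h1 h2 => h t h2 h1, fun h t h1 h2 => h t h2 h1⟩
  have hAm : ∀ k, MeasurableSet (A (k + 1)) := by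
    intro k
    rw [hAA']
    exact (hA'm k).preimage (by fun_prop)
  let a : ℕ → ℝ≥0∞ := fun k => ∫⁻ ω, (A k).indicator (fun ω => v (ω k)) ω ∂(pathLaw κ x)
  -- With `a k` = E[v(X_k); no visit to B in [m, k)], each further slot spent off B costs at least
  -- its probability; summing over k telescopes.
  have hstep : ∀ k, m ≤ k → pathLaw κ x (A (k + 1)) + a (k + 1) ≤ a k := by
    intro k hk
    have h1 : a (k + 1) = ∫⁻ ω, (A (k + 1)).indicator (fun ω => ∫⁻ z, v z ∂(κ (ω k))) ω
        ∂(pathLaw κ x) := by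
      have := lintegral_pathLaw_succ κ x k
        (g := (A' k).indicator fun _ => 1) (measurable_const.indicator (hA'm k)) hvm
      convert this using 3 with ω ω
      · by_cases h : ω ∈ A (k + 1)
        · rw [Set.indicator_of_mem h, Set.indicator_of_mem (by rw [hAA'] at h; exact h), one_mul]
        · rw [Set.indicator_of_notMem h, Set.indicator_of_notMem (by rw [hAA'] at h; exact h),
            zero_mul]
      · by_cases h : ω ∈ A (k + 1)
        · rw [Set.indicator_of_mem h, Set.indicator_of_mem (by rw [hAA'] at h; exact h), one_mul]
        · rw [Set.indicator_of_notMem h, Set.indicator_of_notMem (by rw [hAA'] at h; exact h),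
            zero_mul]
    have h2 : pathLaw κ x (A (k + 1)) =
        ∫⁻ ω, (A (k + 1)).indicator (fun _ => 1) ω ∂(pathLaw κ x) := by
      rw [lintegral_indicator (hAm k)]; simp
    rw [h1, h2, ← lintegral_add_left (measurable_const.indicator (hAm k))]
    refine lintegral_mono fun ω => ?_
    by_cases h : ω ∈ A (k + 1)
    · have h' : ω ∈ A k := fun t ht ht' => h t ht (by omega)
      simp only [Set.indicator_of_mem h, Set.indicator_of_mem h']
      rw [add_comm]
      exact hv _ (h k hk (by omega))
    · simp [Set.indicator_of_notMem h]
  have hsum : ∀ N, ∑ i ∈ Finset.range N, pathLaw κ x (A (m + i + 1)) + a (m + N) ≤ a m := by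
    intro N
    induction N with
    | zero => simp
    | succ N ih =>
      rw [Finset.sum_range_succ, add_assoc]
      exact (add_le_add le_rfl (hstep (m + N) (by omega))).trans ih
  have ham : a m = ∫⁻ ω, v (ω m) ∂(pathLaw κ x) := by
    refine lintegral_congr fun ω => ?_
    exact Set.indicator_of_mem (fun t h1 h2 => absurd h1 (by omega)) _
  calc ∫⁻ ω, entranceTime m B ω ∂(pathLaw κ x)
      ≤ ∫⁻ ω, (m + ∑' i : ℕ, (A (m + i + 1)).indicator (fun _ => (1 : ℝ≥0∞)) ω) ∂(pathLaw κ x) :=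
        lintegral_mono fun ω => entranceTime_le_tsum m B ω
    _ = m + ∑' i : ℕ, pathLaw κ x (A (m + i + 1)) := by
        rw [lintegral_add_left measurable_const, lintegral_const, measure_univ, mul_one,
          lintegral_tsum fun i => (measurable_const.indicator (hAm _)).aemeasurable]
        congr 2 with i
        rw [lintegral_indicator (hAm _)]; simp
    _ ≤ m + a m := by
        gcongr
        refine ENNReal.tsum_le_of_sum_range_le fun N => le_trans le_self_add (hsum N)
    _ = _ := by rw [ham]

lemma meanHittingTime_le [DiscreteMeasurableSpace S] (x : S) (B : Set S)
    {v : S → ℝ≥0∞} (hv : ∀ y ∉ B, (∫⁻ z, v z ∂(κ y)) + 1 ≤ v y) :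
    meanHittingTime κ x B ≤ v x := by
  refine (lintegral_entranceTime_le κ x 0 B hv).trans ?_
  have : ∫⁻ ω, v (ω 0) ∂(pathLaw κ x) = ∫⁻ ω, v x ∂(pathLaw κ x) :=
    lintegral_congr_ae ((pathLaw_start κ x).mono fun ω h => by simp only [h])
  simp [this]

lemma meanReturnTime_le [DiscreteMeasurableSpace S] (x : S)
    {v : S → ℝ≥0∞} (hv : ∀ y ≠ x, (∫⁻ z, v z ∂(κ y)) + 1 ≤ v y) :
    meanReturnTime κ x ≤ 1 + ∫⁻ z, v z ∂(κ x) := by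
  refine (lintegral_entranceTime_le κ x 1 {x} hv).trans ?_
  have h := lintegral_pathLaw_succ κ x 0 (g := fun _ => 1) measurable_const
    (v := v) Measurable.of_discrete
  simp only [one_mul, zero_add] at h
  have h' : ∫⁻ ω, ∫⁻ z, v z ∂(κ (ω 0)) ∂(pathLaw κ x) =
      ∫⁻ ω, ∫⁻ z, v z ∂(κ x) ∂(pathLaw κ x) :=
    lintegral_congr_ae ((pathLaw_start κ x).mono fun ω h => by simp only [h])
  rw [h, h']
  simp

end PathLaw

/-! ### The Foster–Lyapunov criterion without irreducibility. -/

section FosterLyapunov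

set_option linter.unusedSectionVars false

variable {S : Type*} [MeasurableSpace S]

open Classical in
/-- The probability that the chain started at `y` visits `B` during the first `k` transitions. -/
noncomputable def hitProb (κ : Kernel S S) (B : Set S) : ℕ → S → ℝ≥0∞
  | 0, y => if y ∈ B then 1 else 0
  | k + 1, y => if y ∈ B then 1 else ∫⁻ z, hitProb κ B k z ∂(κ y)

open Classical in
/-- The probability that the chain started at `y` avoids `B` during the first `k` transitions. -/
noncomputable def avoidProb (κ : Kernel S S) (B : Set S) : ℕ → S → ℝ≥0∞
  | 0, y => if y ∈ B then 0 else 1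
  | k + 1, y => if y ∈ B then 0 else ∫⁻ z, avoidProb κ B k z ∂(κ y)

variable [DiscreteMeasurableSpace S] (κ : Kernel S S) [IsMarkovKernel κ]

lemma avoidProb_add_hitProb (B : Set S) (k : ℕ) (y : S) :
    avoidProb κ B k y + hitProb κ B k y = 1 := by
  induction k generalizing y with
  | zero => by_cases h : y ∈ B <;> simp [avoidProb, hitProb, h]
  | succ k ih =>
    by_cases h : y ∈ B
    · simp [avoidProb, hitProb, h]
    · simp only [avoidProb, hitProb, h, if_false]
      rw [← lintegral_add_left Measurable.of_discrete]
      simp [ih]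

lemma avoidProb_le_one (B : Set S) (k : ℕ) (y : S) : avoidProb κ B k y ≤ 1 :=
  le_self_add.trans (avoidProb_add_hitProb κ B k y).le

lemma hitProb_mono (B : Set S) (y : S) : Monotone fun k => hitProb κ B k y := by
  refine monotone_nat_of_le_succ fun k => ?_
  induction k generalizing y with
  | zero => by_cases h : y ∈ B <;> simp [hitProb, h]
  | succ k ih =>
    by_cases h : y ∈ B
    · simp [hitProb, h]
    · have h1 : hitProb κ B (k + 1) y = ∫⁻ z, hitProb κ B k z ∂(κ y) := by
        simp [hitProb, h]
      have h2 : hitProb κ B (k + 1 + 1) y = ∫⁻ z, hitProb κ B (k + 1) z ∂(κ y) := by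
        rw [hitProb, if_neg h]
      rw [h1, h2]
      exact lintegral_mono fun z => ih z

lemma Reaches.exists_hitProb_pos {B : Set S} {y z : S} (h : Reaches κ y z) (hz : z ∈ B) :
    ∃ k, 0 < hitProb κ B k y := by
  induction h using Relation.ReflTransGen.head_induction_on with
  | refl => exact ⟨0, by simp [hitProb, hz]⟩
  | @head a c hab _ ih =>
    obtain ⟨k, hk⟩ := ih
    refine ⟨k + 1, ?_⟩
    by_cases ha : a ∈ B
    · simp [hitProb, ha]
    · rw [hitProb, if_neg ha]
      calc 0 < hitProb κ B k c * κ a {c} := ENNReal.mul_pos hk.ne' hab.ne'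
        _ = ∫⁻ z in {c}, hitProb κ B k z ∂(κ a) := by rw [lintegral_singleton]
        _ ≤ _ := setLIntegral_le_lintegral _ _

/-- If a function has drift at most `-1` off a finite set, and `B` can be reached from every point
of that finite set, then a bounded perturbation of it has drift at most `-1` off `B`. -/
lemma exists_drift_off {v : S → ℝ≥0∞} {F : Set S} (hF : F.Finite)
    (hv : ∀ y ∉ F, (∫⁻ z, v z ∂(κ y)) + 1 ≤ v y) (hfin : ∀ y ∈ F, ∫⁻ z, v z ∂(κ y) < ∞)
    (B : Set S) (hB : ∀ y ∈ F, ∃ z ∈ B, Reaches κ y z) :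
    ∃ (u : S → ℝ≥0∞) (c : ℝ≥0∞), c < ∞ ∧ (∀ y, u y ≤ v y + c) ∧
      ∀ y ∉ B, (∫⁻ z, u z ∂(κ y)) + 1 ≤ u y := by
  obtain ⟨N, hN⟩ : ∃ N, ∀ y ∈ F, 0 < hitProb κ B N y := by
    choose! z hzB hz using hB
    have : ∀ y ∈ F, ∃ k, 0 < hitProb κ B k y := fun y hy =>
      (hz y hy).exists_hitProb_pos κ (hzB y hy)
    choose! k hk using this
    obtain ⟨N, hN⟩ := (hF.image k).bddAbove
    exact ⟨N, fun y hy => (hk y hy).trans_le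
      (hitProb_mono κ B y (hN (Set.mem_image_of_mem k hy)))⟩
  -- K is large enough that a gain of K times the hitting probability pays for the uncontrolled
  -- drift of v on F.
  obtain ⟨K, hK, hKF⟩ : ∃ K : ℝ≥0∞, K < ∞ ∧
      ∀ y ∈ F, (∫⁻ z, v z ∂(κ y)) + 1 ≤ K * hitProb κ B N y := by
    refine ⟨∑ y ∈ hF.toFinset, ((∫⁻ z, v z ∂(κ y)) + 1) / hitProb κ B N y, ?_, fun y hy => ?_⟩
    · refine ENNReal.sum_lt_top.2 fun y hy => ?_
      have hy' := hF.mem_toFinset.1 hy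
      exact ENNReal.div_lt_top (ENNReal.add_lt_top.2 ⟨hfin y hy', ENNReal.one_lt_top⟩).ne
        (hN y hy').ne'
    · have hne : hitProb κ B N y ≠ ∞ :=
        ((le_add_self.trans (avoidProb_add_hitProb κ B N y).le).trans_lt ENNReal.one_lt_top).ne
      rw [← ENNReal.div_le_iff (hN y hy).ne' hne]
      exact Finset.single_le_sum (f := fun y => ((∫⁻ z, v z ∂(κ y)) + 1) / hitProb κ B N y)
        (fun _ _ => zero_le) (hF.mem_toFinset.2 hy)
  -- `R` is the mean of min(τ_B, N). One step off B shifts the index of the sum, so `R` drops by 1 -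
  -- `avoidProb κ B N y`, which is `hitProb κ B N y`. The perturbed function is v + K R.
  let R : S → ℝ≥0∞ := fun y => ∑ j ∈ Finset.range N, avoidProb κ B j y
  have hR : ∀ y, R y ≤ N := fun y =>
    (Finset.sum_le_sum fun j _ => avoidProb_le_one κ B j y).trans (by simp)
  have hRstep : ∀ y ∉ B, (∫⁻ z, R z ∂(κ y)) + hitProb κ B N y = R y := by
    intro y hy
    have h1 : ∫⁻ z, R z ∂(κ y) = ∑ j ∈ Finset.range N, avoidProb κ B (j + 1) y := by
      rw [lintegral_finsetSum _ fun _ _ => Measurable.of_discrete]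
      exact Finset.sum_congr rfl fun j _ => by rw [avoidProb, if_neg hy]
    have h2 := Finset.sum_range_succ' (fun j => avoidProb κ B j y) N
    have h3 := Finset.sum_range_succ (fun j => avoidProb κ B j y) N
    have h4 : avoidProb κ B 0 y = 1 := by simp [avoidProb, hy]
    have h5 := avoidProb_add_hitProb κ B N y
    have h6 : avoidProb κ B N y ≠ ∞ :=
      ((avoidProb_le_one κ B N y).trans_lt ENNReal.one_lt_top).ne
    have h7 : (∫⁻ z, R z ∂(κ y)) + hitProb κ B N y + avoidProb κ B N y =
        R y + avoidProb κ B N y := by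
      rw [add_assoc, add_comm (hitProb κ B N y), h5, h1, ← h4, ← h2, h3]
    exact (ENNReal.add_left_inj h6).1 h7
  refine ⟨fun y => v y + K * R y, K * N, ENNReal.mul_lt_top hK (ENNReal.natCast_lt_top N),
    fun y => add_le_add le_rfl (mul_le_mul_right (hR y) K), fun y hy => ?_⟩
  rw [lintegral_add_left Measurable.of_discrete, lintegral_const_mul _ Measurable.of_discrete]
  by_cases hyF : y ∈ F
  · calc (∫⁻ z, v z ∂(κ y)) + K * (∫⁻ z, R z ∂(κ y)) + 1
        = ((∫⁻ z, v z ∂(κ y)) + 1) + K * (∫⁻ z, R z ∂(κ y)) := by ring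
      _ ≤ K * hitProb κ B N y + K * (∫⁻ z, R z ∂(κ y)) := by gcongr; exact hKF y hyF
      _ = K * R y := by rw [← hRstep y hy]; ring
      _ ≤ _ := le_add_self
  · calc (∫⁻ z, v z ∂(κ y)) + K * (∫⁻ z, R z ∂(κ y)) + 1
        = ((∫⁻ z, v z ∂(κ y)) + 1) + K * (∫⁻ z, R z ∂(κ y)) := by ring
      _ ≤ v y + K * R y := by
        gcongr
        · exact hv y hyF
        · rw [← hRstep y hy]; exact le_self_add

variable [Countable S]

lemma ae_mem_of_closed {D : Set S} (y : S) (hD : ∀ z, 0 < κ y {z} → z ∈ D) :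
    ∀ᵐ z ∂(κ y), z ∈ D := by
  rw [ae_iff_of_countable]
  exact fun z hz => hD z (pos_iff_ne_zero.2 hz)

/-- A set off which a finite function has drift at most `-1` can be reached from everywhere. -/
lemma exists_reaches_of_drift {v : S → ℝ≥0∞} {F : Set S}
    (hv : ∀ y ∉ F, (∫⁻ z, v z ∂(κ y)) + 1 ≤ v y) {w : S} (hw : v w < ∞) :
    ∃ f ∈ F, Reaches κ w f := by
  by_contra! hcon
  -- If w never reaches F, the drift inequality holds at all states reachable from w, and each use
  -- of it raises the lower bound on v there by one.
  have key : ∀ N : ℕ, ∀ y, Reaches κ w y → (N : ℝ≥0∞) ≤ v y := by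
    intro N
    induction N with
    | zero => simp
    | succ N ih =>
      intro y hy
      refine le_trans ?_ (hv y fun hyF => hcon y hyF hy)
      push_cast
      gcongr
      calc (N : ℝ≥0∞) = ∫⁻ _, (N : ℝ≥0∞) ∂(κ y) := by simp
        _ ≤ _ := lintegral_mono_ae
          (ae_mem_of_closed κ (D := {z | (N : ℝ≥0∞) ≤ v z}) y fun z hz => ih z (hy.tail hz))
  obtain ⟨N, hN⟩ := ENNReal.exists_nat_gt hw.ne
  exact absurd (key N w Relation.ReflTransGen.refl) (not_le.2 hN)

/-- The exceptional set is moved to {x} ∪ Cᶜ: states of C reach x, the others already lie in it.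
Setting the function to ∞ off C makes the drift inequality trivial there, and costs nothing on C
because C is closed. -/
lemma isPosRecState_of_drift {v : S → ℝ≥0∞} {F : Set S} (hF : F.Finite)
    (hv : ∀ y ∉ F, (∫⁻ z, v z ∂(κ y)) + 1 ≤ v y) (hfin : ∀ y, ∫⁻ z, v z ∂(κ y) < ∞)
    {C : Set S} (hC : IsClosedClass κ C) {x : S} (hx : x ∈ C) : IsPosRecState κ x := by
  classical
  obtain ⟨u, c, hc, huv, hu⟩ := exists_drift_off κ (hF.insert x)
    (fun y hy => hv y fun h => hy (Set.mem_insert_of_mem x h)) (fun y _ => hfin y)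
    (insert x Cᶜ) (fun y _ => by
      by_cases hyC : y ∈ C
      · exact ⟨x, Set.mem_insert x _, (hC.2 y hyC x).2 hx⟩
      · exact ⟨y, Set.mem_insert_of_mem x hyC, Relation.ReflTransGen.refl⟩)
  have hint : ∀ y ∈ C, ∫⁻ z, (if z ∈ C then u z else ∞) ∂(κ y) = ∫⁻ z, u z ∂(κ y) := by
    intro y hy
    refine lintegral_congr_ae ?_
    filter_upwards [ae_mem_of_closed κ (D := C) y fun z hz =>
      (hC.2 y hy z).1 (Relation.ReflTransGen.single hz)] with z hz
    simp [hz]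
  refine (meanReturnTime_le κ x (v := fun z => if z ∈ C then u z else ∞) ?_).trans_lt ?_
  · intro y hyx
    by_cases hyC : y ∈ C
    · rw [hint y hyC, if_pos hyC]
      exact hu y (by simp [hyx, hyC])
    · simp [hyC]
  · rw [hint x hx]
    refine ENNReal.add_lt_top.2 ⟨ENNReal.one_lt_top, (lintegral_mono huv).trans_lt ?_⟩
    rw [lintegral_add_right _ measurable_const]
    simpa using ⟨hfin x, hc⟩

/-- If every state reaches a finite set, then every state reaches a closed communicating class. -/
lemma exists_reaches_closedClass {F : Set S} (hF : F.Finite)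
    (h : ∀ w, ∃ f ∈ F, Reaches κ w f) (y : S) : ∃ z C, Reaches κ y z ∧ IsClosedClass κ C ∧ z ∈ C := by
  have htrans : ∀ {a b c}, Reaches κ a b → Reaches κ b c → Reaches κ a c :=
    fun h1 h2 => Relation.ReflTransGen.trans h1 h2
  let G : S → Set S := fun w => {f ∈ F | Reaches κ w f}
  -- Among the states of F reachable from y, z reaches the fewest states of F. Any w reached from z
  -- leads to some f in F with `G f ⊆ G z`; minimality forces equality, so f leads back to z.
  obtain ⟨z, hz, hmin⟩ := Set.exists_min_image (G y) (fun z => (G z).ncard)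
    (hF.subset fun _ h => h.1) (h y)
  have hback : ∀ w, Reaches κ z w → Reaches κ w z := by
    intro w hw
    obtain ⟨f, hfF, hf⟩ := h w
    have hzf := htrans hw hf
    have hsub : G f ⊆ G z := fun g hg => ⟨hg.1, htrans hzf hg.2⟩
    have heq : G f = G z := Set.eq_of_subset_of_ncard_le hsub
      (hmin f ⟨hfF, htrans hz.2 hzf⟩) (hF.subset fun _ h => h.1)
    have : z ∈ G f := heq ▸ (⟨hz.1, Relation.ReflTransGen.refl⟩ : z ∈ G z)
    exact htrans hf this.2
  refine ⟨z, {w | Reaches κ z w}, hz.2, ⟨⟨z, Relation.ReflTransGen.refl⟩, fun w hw w' => ?_⟩,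
    Relation.ReflTransGen.refl⟩
  exact ⟨fun h => htrans hw h, fun h => htrans (hback w hw) h⟩

/-- The Foster–Lyapunov criterion, for a chain that need not be irreducible. -/
theorem positiveRecurrent_of_drift {v : S → ℝ≥0∞} {F : Set S} (hF : F.Finite)
    (hvfin : ∀ y, v y < ∞) (hv : ∀ y ∉ F, (∫⁻ z, v z ∂(κ y)) + 1 ≤ v y)
    (hfin : ∀ y, ∫⁻ z, v z ∂(κ y) < ∞) : PositiveRecurrent κ := by
  have hrec : ∀ C, IsClosedClass κ C → ∀ x ∈ C, IsPosRecState κ x :=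
    fun C hC x hx => isPosRecState_of_drift κ hF hv hfin hC hx
  refine ⟨hrec, fun x => ?_⟩
  obtain ⟨u, c, hc, huv, hu⟩ := exists_drift_off κ hF hv (fun y _ => hfin y)
    {y | IsPosRecState κ y} fun y _ => by
      obtain ⟨z, C, hyz, hC, hz⟩ := exists_reaches_closedClass κ hF
        (fun w => exists_reaches_of_drift κ hv (hvfin w)) y
      exact ⟨z, hrec C hC z hz, hyz⟩
  exact (meanHittingTime_le κ x _ hu).trans_lt
    ((huv x).trans_lt (ENNReal.add_lt_top.2 ⟨hvfin x, hc⟩))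

end FosterLyapunov

/-! ### The Markov property of the queueing chain. -/

lemma Policy.measurable_decision_joint {n : ℕ} (pol : Policy n) (μ : Fin n → {r : ℝ // 0 < r}) :
    Measurable fun p : (Fin n → ℕ) × (I × I) => pol.decision μ p.1 p.2.1 p.2.2 :=
  measurable_from_prod_countable_right fun q => pol.measurable_decision μ q

lemma Policy.step_of_lt {n : ℕ} (pol : Policy n) (μ : Fin n → {r : ℝ // 0 < r}) (x : pol.State)
    (u : (ℕ × (Fin n → ℕ)) × (I × I)) (h : (x.2.2 : ℕ) + 1 < pol.T) :
    pol.step μ x u =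
      (Policy.nextQueue x.1 (x.2.1 x.2.2) u.1.1 u.1.2, x.2.1, ⟨x.2.2 + 1, h⟩) :=
  dif_pos h

lemma Policy.step_of_not_lt {n : ℕ} (pol : Policy n) (μ : Fin n → {r : ℝ // 0 < r})
    (x : pol.State) (u : (ℕ × (Fin n → ℕ)) × (I × I)) (h : ¬ (x.2.2 : ℕ) + 1 < pol.T) :
    pol.step μ x u =
      (Policy.nextQueue x.1 (x.2.1 x.2.2) u.1.1 u.1.2,
        pol.decision μ (Policy.nextQueue x.1 (x.2.1 x.2.2) u.1.1 u.1.2) u.2.1 u.2.2,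
        ⟨0, pol.T_pos⟩) :=
  dif_neg h

/-- The inputs that determine the chain up to time `t`, for cycles of length `T`. -/
def Input.past (T t : ℕ) : Set Input :=
  {i | match i with
    | .queue => True
    | .arrival s => s < t
    | .service s => s < t
    | .sortSeed k => k ≤ t / T
    | .decisionSeed k => k ≤ t / T}

lemma Input.past_mono (T : ℕ) : Monotone (Input.past T) := by
  intro s t hst i hi
  have := Nat.div_le_div_right (c := T) hst
  cases i <;> simp only [Input.past, Set.mem_ofPred_eq] at hi ⊢ <;> omega

section System

set_option linter.unusedSectionVars false

variable {n : ℕ} {Ω : Type*} [MeasurableSpace Ω] {P : Measure Ω} {pol : Policy n}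
  {μ : Fin n → {r : ℝ // 0 < r}} {α : Measure ℕ} {ς : Measure (Fin n → ℕ)}
  {A : ℕ → Ω → ℕ} {S : ℕ → Ω → Fin n → ℕ} {V W : ℕ → Ω → I} {Q : ℕ → Ω → Fin n → ℕ}

/-- The σ-algebra generated by a set of inputs. -/
abbrev inputsAlgebra (Q₀ : Ω → Fin n → ℕ) (A : ℕ → Ω → ℕ) (S : ℕ → Ω → Fin n → ℕ)
    (V W : ℕ → Ω → I) (J : Set Input) : MeasurableSpace Ω :=
  ⨆ i ∈ J, inputAlgebra Q₀ A S V W i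

lemma inputAlgebra_le_inputsAlgebra {Q₀ : Ω → Fin n → ℕ} {J : Set Input} {i : Input}
    (hi : i ∈ J) : inputAlgebra Q₀ A S V W i ≤ inputsAlgebra Q₀ A S V W J :=
  le_iSup₂_of_le i hi le_rfl

lemma inputsAlgebra_mono {Q₀ : Ω → Fin n → ℕ} {J K : Set Input} (h : J ⊆ K) :
    inputsAlgebra Q₀ A S V W J ≤ inputsAlgebra Q₀ A S V W K :=
  biSup_mono fun _ hi => h hi

namespace IsQueueingSystem

lemma measurable_arrival {J : Set Input} {t : ℕ} (ht : .arrival t ∈ J) :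
    Measurable[inputsAlgebra (Q 0) A S V W J] (A t) :=
  (comap_measurable (A t)).mono (inputAlgebra_le_inputsAlgebra ht) le_rfl

lemma measurable_service {J : Set Input} {t : ℕ} (ht : .service t ∈ J) :
    Measurable[inputsAlgebra (Q 0) A S V W J] (S t) :=
  (comap_measurable (S t)).mono (inputAlgebra_le_inputsAlgebra ht) le_rfl

lemma measurable_sortSeed {J : Set Input} {k : ℕ} (hk : .sortSeed k ∈ J) :
    Measurable[inputsAlgebra (Q 0) A S V W J] (V k) :=
  (comap_measurable (V k)).mono (inputAlgebra_le_inputsAlgebra hk) le_rfl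

lemma measurable_decisionSeed {J : Set Input} {k : ℕ} (hk : .decisionSeed k ∈ J) :
    Measurable[inputsAlgebra (Q 0) A S V W J] (W k) :=
  (comap_measurable (W k)).mono (inputAlgebra_le_inputsAlgebra hk) le_rfl

variable (h : IsQueueingSystem P pol μ α ς A S V W Q)
include h

lemma inputAlgebra_le (i : Input) : inputAlgebra (Q 0) A S V W i ≤ ‹MeasurableSpace Ω› := by
  cases i with
  | queue => exact h.measurable_init.comap_le
  | arrival t => exact (h.measurable_A t).comap_le
  | service t => exact (h.measurable_S t).comap_le
  | sortSeed k => exact (h.measurable_V k).comap_le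
  | decisionSeed k => exact (h.measurable_W k).comap_le

lemma indep_inputsAlgebra {J K : Set Input} (hJK : Disjoint J K) :
    Indep (inputsAlgebra (Q 0) A S V W J) (inputsAlgebra (Q 0) A S V W K) P :=
  indep_iSup_of_disjoint h.inputAlgebra_le h.indep hJK

lemma indepFun_of_inputs {β γ : Type*} [MeasurableSpace β] [MeasurableSpace γ] {f : Ω → β}
    {g : Ω → γ} {J K : Set Input} (hJK : Disjoint J K)
    (hf : Measurable[inputsAlgebra (Q 0) A S V W J] f)
    (hg : Measurable[inputsAlgebra (Q 0) A S V W K] g) : IndepFun f g P :=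
  indep_of_indep_of_le_left (indep_of_indep_of_le_right (h.indep_inputsAlgebra hJK) hg.comap_le)
    hf.comap_le

lemma map_inputs [IsProbabilityMeasure P] (t k : ℕ) :
    P.map (fun ω => ((A t ω, S t ω), (V k ω, W k ω))) =
      (α.prod ς).prod ((volume : Measure I).prod (volume : Measure I)) := by
  have hAS : IndepFun (A t) (S t) P :=
    h.indepFun_of_inputs (J := {.arrival t}) (K := {.service t}) (by simp)
      (measurable_arrival rfl) (measurable_service rfl)
  have hVW : IndepFun (V k) (W k) P :=
    h.indepFun_of_inputs (J := {.sortSeed k}) (K := {.decisionSeed k}) (by simp)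
      (measurable_sortSeed rfl) (measurable_decisionSeed rfl)
  have hJ : IndepFun (fun ω => (A t ω, S t ω)) (fun ω => (V k ω, W k ω)) P :=
    h.indepFun_of_inputs (J := {.arrival t, .service t}) (K := {.sortSeed k, .decisionSeed k})
      (by simp)
      ((measurable_arrival (by simp)).prodMk (measurable_service (by simp)))
      ((measurable_sortSeed (by simp)).prodMk (measurable_decisionSeed (by simp)))
  have mA := h.measurable_A t
  have mS := h.measurable_S t
  have mV := h.measurable_V k
  have mW := h.measurable_W k
  rw [(indepFun_iff_map_prod_eq_prod_map_map (by fun_prop) (by fun_prop)).1 hJ,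
    (indepFun_iff_map_prod_eq_prod_map_map (by fun_prop) (by fun_prop)).1 hAS,
    (indepFun_iff_map_prod_eq_prod_map_map (by fun_prop) (by fun_prop)).1 hVW,
    h.law_A, h.law_S, h.law_V, h.law_W]

/-- The seeds of the next cycle are supplied in every slot, although `step` reads them only in the
last slot of a cycle; thus one kernel serves all times. -/
lemma chain_succ (t : ℕ) (ω : Ω) :
    chain pol μ Q V W (t + 1) ω = pol.step μ (chain pol μ Q V W t ω)
      ((A t ω, S t ω), (V (t / pol.T + 1) ω, W (t / pol.T + 1) ω)) := by
  have hT := pol.T_pos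
  have hdm := Nat.div_add_mod t pol.T
  have hlt := Nat.mod_lt t hT
  by_cases hc : t % pol.T + 1 < pol.T
  · have hdiv : (t + 1) / pol.T = t / pol.T := by
      rw [mul_comm] at hdm
      rw [Nat.div_eq_iff hT]
      omega
    have hmod : (t + 1) % pol.T = t % pol.T + 1 := by
      have := Nat.div_add_mod (t + 1) pol.T
      rw [hdiv] at this
      omega
    rw [Policy.step_of_lt (x := chain pol μ Q V W t ω) (h := hc)]
    simp only [chain, hdiv, h.dynamics t ω]
    congr 2
    exact Fin.ext hmod
  · have hmod' : t % pol.T + 1 = pol.T := by omega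
    have ht : t + 1 = (t / pol.T + 1) * pol.T := by
      rw [add_mul, one_mul, mul_comm]; omega
    have hdiv : (t + 1) / pol.T = t / pol.T + 1 := by
      rw [ht, Nat.mul_div_cancel _ hT]
    have hmod : (t + 1) % pol.T = 0 := by
      rw [ht, Nat.mul_mod_left]
    rw [Policy.step_of_not_lt (x := chain pol μ Q V W t ω) (h := hc)]
    simp only [chain, hdiv, h.dynamics t ω]
    congr 2
    · rw [cycleDecision, ← ht, h.dynamics t ω]
    · exact Fin.ext hmod

lemma measurable_chain_past (t : ℕ) :
    Measurable[inputsAlgebra (Q 0) A S V W (Input.past pol.T t)] (chain pol μ Q V W t) := by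
  induction t with
  | zero =>
    have hQ : Measurable[inputsAlgebra (Q 0) A S V W (Input.past pol.T 0)] (Q 0) :=
      (comap_measurable (Q 0)).mono (inputAlgebra_le_inputsAlgebra (i := .queue) trivial) le_rfl
    have hV : Measurable[inputsAlgebra (Q 0) A S V W (Input.past pol.T 0)] (V 0) :=
      measurable_sortSeed (Nat.zero_le _)
    have hW : Measurable[inputsAlgebra (Q 0) A S V W (Input.past pol.T 0)] (W 0) :=
      measurable_decisionSeed (Nat.zero_le _)
    have hd := (pol.measurable_decision_joint μ).comp (hQ.prodMk (hV.prodMk hW))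
    have h0 : chain pol μ Q V W 0 = fun ω =>
        (Q 0 ω, pol.decision μ (Q 0 ω) (V 0 ω) (W 0 ω), cyclePos pol 0) := by
      funext ω
      simp [chain, cycleDecision]
    rw [h0]
    exact hQ.prodMk (hd.prodMk measurable_const)
  | succ t ih =>
    have hmono := inputsAlgebra_mono (Q₀ := Q 0) (A := A) (S := S) (V := V) (W := W)
      (Input.past_mono pol.T (Nat.le_succ t))
    have hX := ih.mono hmono le_rfl
    have hA : Measurable[inputsAlgebra (Q 0) A S V W (Input.past pol.T (t + 1))] (A t) :=
      measurable_arrival (Nat.lt_succ_self t)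
    have hS : Measurable[inputsAlgebra (Q 0) A S V W (Input.past pol.T (t + 1))] (S t) :=
      measurable_service (Nat.lt_succ_self t)
    have hQ : Measurable[inputsAlgebra (Q 0) A S V W (Input.past pol.T (t + 1))] (Q (t + 1)) := by
      have h1 : Q (t + 1) = (fun p : pol.State × ℕ × (Fin n → ℕ) =>
          Policy.nextQueue p.1.1 (p.1.2.1 p.1.2.2) p.2.1 p.2.2) ∘
          fun ω => (chain pol μ Q V W t ω, A t ω, S t ω) := by
        funext ω
        exact h.dynamics t ω
      rw [h1]
      exact Measurable.of_discrete.comp (hX.prodMk (hA.prodMk hS))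
    by_cases hc : t % pol.T + 1 < pol.T
    · have h1 : chain pol μ Q V W (t + 1) =
          (fun p : (Fin n → ℕ) × pol.State => (p.1, p.2.2.1, (⟨t % pol.T + 1, hc⟩ : Fin pol.T))) ∘
            fun ω => (Q (t + 1) ω, chain pol μ Q V W t ω) := by
        funext ω
        rw [h.chain_succ t ω, Policy.step_of_lt (x := chain pol μ Q V W t ω) (h := hc)]
        simp only [chain, cyclePos, Function.comp, h.dynamics t ω]
      rw [h1]
      exact Measurable.of_discrete.comp (hQ.prodMk hX)
    · have hk : t / pol.T + 1 ≤ (t + 1) / pol.T := by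
        rw [Nat.le_div_iff_mul_le pol.T_pos]
        have := Nat.div_add_mod t pol.T
        rw [add_mul, one_mul, mul_comm]
        omega
      have hV : Measurable[inputsAlgebra (Q 0) A S V W (Input.past pol.T (t + 1))]
          (V (t / pol.T + 1)) := measurable_sortSeed hk
      have hW : Measurable[inputsAlgebra (Q 0) A S V W (Input.past pol.T (t + 1))]
          (W (t / pol.T + 1)) := measurable_decisionSeed hk
      have hd := (pol.measurable_decision_joint μ).comp (hQ.prodMk (hV.prodMk hW))
      have h1 : chain pol μ Q V W (t + 1) = fun ω => (Q (t + 1) ω,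
          pol.decision μ (Q (t + 1) ω) (V (t / pol.T + 1) ω) (W (t / pol.T + 1) ω),
          ⟨0, pol.T_pos⟩) := by
        funext ω
        rw [h.chain_succ t ω, Policy.step_of_not_lt (x := chain pol μ Q V W t ω) (h := hc)]
        simp only [chain, cyclePos, h.dynamics t ω]
      rw [h1]
      exact hQ.prodMk (hd.prodMk measurable_const)

theorem isMarkovChain [IsProbabilityMeasure P] :
    IsMarkovChain P (chain pol μ Q V W) (pol.chainKernel μ α ς) := by
  have hle : ∀ J, inputsAlgebra (Q 0) A S V W J ≤ ‹MeasurableSpace Ω› :=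
    fun J => iSup₂_le fun i _ => h.inputAlgebra_le i
  refine ⟨fun t => (h.measurable_chain_past t).mono (hle _) le_rfl, fun t x y => ?_⟩
  set k := t / pol.T + 1 with hk
  let U : Ω → (ℕ × (Fin n → ℕ)) × (I × I) := fun ω => ((A t ω, S t ω), (V k ω, W k ω))
  let J : Set Input := {.arrival t, .service t, .sortSeed k, .decisionSeed k}
  have hU : Measurable[inputsAlgebra (Q 0) A S V W J] U :=
    ((measurable_arrival (by simp [J])).prodMk (measurable_service (by simp [J]))).prodMk
      ((measurable_sortSeed (by simp [J])).prodMk (measurable_decisionSeed (by simp [J])))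
  -- The chain up to time t uses arrivals and services before t and seeds of index at most t / T,
  -- whereas the transition uses those of slot t and seeds of index t / T + 1.
  have hJ : Disjoint (Input.past pol.T t) J := by
    rw [Set.disjoint_right]
    rintro i (rfl | rfl | rfl | rfl) <;> simp [Input.past, hk]
  have hH : MeasurableSet[inputsAlgebra (Q 0) A S V W (Input.past pol.T t)]
      {ω | ∀ s ≤ t, chain pol μ Q V W s ω = x s} := by
    have : {ω | ∀ s ≤ t, chain pol μ Q V W s ω = x s} =
        ⋂ s, ⋂ (_ : s ≤ t), chain pol μ Q V W s ⁻¹' {x s} := by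
      ext ω; simp
    rw [this]
    refine MeasurableSet.iInter fun s => MeasurableSet.iInter fun hs => ?_
    exact inputsAlgebra_mono (Input.past_mono pol.T hs) _
      (h.measurable_chain_past s (measurableSet_singleton _))
  have hE : MeasurableSet (pol.step μ (x t) ⁻¹' {y}) :=
    pol.measurable_step μ (x t) (measurableSet_singleton y)
  have hset : {ω | (∀ s ≤ t, chain pol μ Q V W s ω = x s) ∧ chain pol μ Q V W (t + 1) ω = y} =
      {ω | ∀ s ≤ t, chain pol μ Q V W s ω = x s} ∩ U ⁻¹' (pol.step μ (x t) ⁻¹' {y}) := by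
    ext ω
    simp only [Set.mem_ofPred_eq, Set.mem_inter_iff, Set.mem_preimage, Set.mem_singleton_iff]
    refine and_congr_right fun hω => ?_
    rw [h.chain_succ t ω, hω t le_rfl]
  rw [hset, (Indep_iff _ _ _).1 (h.indep_inputsAlgebra hJ) _ _ hH (hU hE)]
  congr 1
  change _ = ((α.prod ς).prod ((volume : Measure I).prod (volume : Measure I))).map
    (pol.step μ (x t)) {y}
  rw [Measure.map_apply (pol.measurable_step μ (x t)) (measurableSet_singleton y),
    ← h.map_inputs t k, Measure.map_apply (hU.mono (hle J) le_rfl) hE]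

end IsQueueingSystem

end System

/-! ### Summation by parts. -/

/-- Summation by parts: an antitone weighted sum whose partial sums are at most `-δ`. -/
lemma sum_mul_le_of_partialSums_le {δ : ℝ} (N : ℕ) (o g : Fin (N + 1) → ℝ) (ho : Antitone o)
    (hg : ∀ m, ∑ l ∈ Finset.Iic m, g l ≤ -δ) :
    ∑ l, o l * g l ≤ o (Fin.last N) * ∑ l, g l - δ * (o 0 - o (Fin.last N)) := by
  induction N with
  | zero => simp
  | succ N ih =>
    have hIic : ∀ m : Fin (N + 1), ∑ l ∈ Finset.Iic m, g l.castSucc =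
        ∑ l ∈ Finset.Iic m.castSucc, g l := by
      intro m
      rw [← Fin.map_castSuccEmb_Iic, Finset.sum_map]
      rfl
    have h1 := ih (fun l => o l.castSucc) (fun l => g l.castSucc)
      (fun _ _ hab => ho (by simpa using hab)) (fun m => by rw [hIic]; exact hg _)
    have h2 := hg (Fin.last N).castSucc
    rw [← hIic, ← Fin.top_eq_last, Finset.Iic_top] at h2
    rw [Fin.sum_univ_castSucc, Fin.sum_univ_castSucc (fun l => g l)]
    have h3 : o (Fin.last (N + 1)) ≤ o (Fin.last N).castSucc := ho (Fin.le_last _)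
    rw [Fin.castSucc_zero] at h1
    -- The induction hypothesis misses the claim by (o_N - o_{N+1}) (G_N + δ) ≤ 0, where G_N is the
    -- partial sum of g through N.
    nlinarith [mul_nonneg (sub_nonneg.2 h3) (sub_nonneg.2 h2)]

/-- The total sum of g is also at most -δ, so summation by parts gives -δ o_0, and o_0 is at least
the average of o. This is the source of ε = δ/n. -/
lemma sum_mul_le_neg_sum {n : ℕ} {δ : ℝ} (hδ : 0 ≤ δ) {o g : Fin n → ℝ}
    (ho : Antitone o) (ho0 : ∀ l, 0 ≤ o l) (hg : ∀ m, ∑ l ∈ Finset.Iic m, g l ≤ -δ) :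
    ∑ l, o l * g l ≤ -(δ / n) * ∑ l, o l := by
  cases n with
  | zero => simp
  | succ N =>
    have h1 := sum_mul_le_of_partialSums_le N o g ho hg
    have h2 := hg (Fin.last N)
    rw [← Fin.top_eq_last, Finset.Iic_top] at h2
    have h3 : ∑ l, o l ≤ (N + 1 : ℕ) * o 0 := by
      have := Finset.sum_le_card_nsmul Finset.univ o (o 0) fun l _ => ho (Fin.zero_le l)
      simpa using this
    have h4 : δ / (N + 1 : ℕ) * ∑ l, o l ≤ δ * o 0 := by
      calc δ / (N + 1 : ℕ) * ∑ l, o l ≤ δ / (N + 1 : ℕ) * ((N + 1 : ℕ) * o 0) := by gcongr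
        _ = δ * o 0 := by field_simp
    nlinarith [mul_le_mul_of_nonneg_left h2 (ho0 (Fin.last N))]

lemma integral_prod_le {X Y : Type*} [MeasurableSpace X] [MeasurableSpace Y] {ν : Measure X}
    {ρ : Measure Y} [SFinite ν] [SFinite ρ] {f : X × Y → ℝ} (hf : Integrable f (ν.prod ρ))
    {g : X → ℝ} (hg : Integrable g ν) (h : ∀ᵐ x ∂ν, ∫ y, f (x, y) ∂ρ ≤ g x) :
    ∫ p, f p ∂(ν.prod ρ) ≤ ∫ x, g x ∂ν := by
  rw [integral_prod f hf]
  exact integral_mono_ae hf.integral_prod_left hg h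

/-! ### The Lyapunov function and its one-step drift. -/

namespace Policy

variable {n : ℕ} (pol : Policy n) (μ : Fin n → {r : ℝ // 0 < r})

/-- The number of slots, from position `k` of the cycle on, in which arrivals are sent to `l`. -/
def remaining (d : Fin pol.T → Fin n) (k : ℕ) (l : Fin n) : ℕ :=
  (Finset.univ.filter fun i : Fin pol.T => k ≤ (i : ℕ) ∧ d i = l).card

lemma remaining_eq_add (d : Fin pol.T → Fin n) (j : Fin pol.T) (l : Fin n) :
    pol.remaining d j l = (if l = d j then 1 else 0) + pol.remaining d (j + 1) l := by
  unfold remaining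
  have : (Finset.univ.filter fun i : Fin pol.T => (j : ℕ) ≤ i ∧ d i = l) =
      (if l = d j then {j} else ∅) ∪
        (Finset.univ.filter fun i : Fin pol.T => (j : ℕ) + 1 ≤ i ∧ d i = l) := by
    ext i
    rcases lt_trichotomy i j with h | h | h
    · have h' : (i : ℕ) < j := h
      split_ifs <;> simp [h.ne] <;> omega
    · subst h
      split_ifs with hl <;> simp [eq_comm, hl]
    · have h' : (j : ℕ) < i := h
      split_ifs <;> simp [h.ne', h.le, h]
  rw [this, Finset.card_union_of_disjoint]
  · split_ifs <;> simp
  · split_ifs <;> simp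

lemma remaining_T (d : Fin pol.T → Fin n) (l : Fin n) : pol.remaining d pol.T l = 0 := by
  simp [remaining, Finset.filter_eq_empty_iff]

/-- The change of the `l`-th queue that is expected during the rest of the cycle if it stays
nonempty, corrected by a small linear term. -/
noncomputable def shift (a ε : ℝ) (d : Fin pol.T → Fin n) (k : ℕ) (l : Fin n) : ℝ :=
  a * pol.remaining d k l - (pol.T - k) * μ l - ε * k

/-- With `a` the mean number of arrivals, this makes the untruncated queue plus shift drift by
exactly -ε in a slot, whichever queue receives the arrivals. -/
lemma shift_eq_add (a ε : ℝ) (d : Fin pol.T → Fin n) (j : Fin pol.T) (l : Fin n) :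
    pol.shift μ a ε d j l =
      pol.shift μ a ε d (j + 1 : ℕ) l + (if l = d j then a else 0) - μ l + ε := by
  unfold shift
  rw [remaining_eq_add]
  split_ifs <;> push_cast <;> ring

lemma shift_T (a ε : ℝ) (d : Fin pol.T → Fin n) (l : Fin n) :
    pol.shift μ a ε d pol.T l = -(ε * pol.T) := by
  simp [shift, remaining_T]

/-- The Lyapunov function. -/
noncomputable def lyapunov (a ε : ℝ) (x : pol.State) : ℝ :=
  ∑ l, ((x.1 l : ℝ) + pol.shift μ a ε x.2.1 x.2.2 l) ^ 2 / pol.γ l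

lemma lyapunov_nonneg (a ε : ℝ) (x : pol.State) : 0 ≤ pol.lyapunov μ a ε x :=
  Finset.sum_nonneg fun l _ => by positivity

lemma exists_shift_bound (a ε : ℝ) :
    ∃ K, 0 ≤ K ∧ ∀ d (j : Fin pol.T) l, |pol.shift μ a ε d j l| ≤ K := by
  obtain ⟨K, hK⟩ := (Set.finite_range fun p : (Fin pol.T → Fin n) × Fin pol.T × Fin n =>
    |pol.shift μ a ε p.1 p.2.1 p.2.2|).bddAbove
  exact ⟨max K 0, le_max_right _ _, fun d j l => (hK ⟨(d, j, l), rfl⟩).trans (le_max_left _ _)⟩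

lemma coe_scaled (q : Fin n → ℕ) (l : Fin n) :
    (pol.scaled q l : ℝ) = (q l : ℝ) / pol.γ l := by
  simp [scaled]

lemma measurable_count (η : Equiv.Perm (Fin n)) (l : Fin n) :
    Measurable fun w => (pol.count μ η l w : ℝ) := by
  have h : Measurable (pol.Y η μ) := measurable_to_countable' fun d => pol.measurableSet_Y η μ d
  exact (Measurable.of_discrete (f := fun d : Fin pol.T → Fin n =>
    ((Finset.univ.filter fun j => d j = η l).card : ℝ))).comp h

lemma integrable_count (η : Equiv.Perm (Fin n)) (l : Fin n) :
    Integrable (fun w => (pol.count μ η l w : ℝ)) := by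
  refine Integrable.of_bound (pol.measurable_count μ η l).aestronglyMeasurable pol.T
    (ae_of_all _ fun w => ?_)
  rw [Real.norm_natCast]
  exact_mod_cast (Finset.card_le_univ _).trans_eq (Fintype.card_fin _)

lemma frac_nonneg (l : Fin n) (η : Equiv.Perm (Fin n)) : 0 ≤ pol.frac μ l η :=
  integral_nonneg fun w => by positivity

lemma integral_count (η : Equiv.Perm (Fin n)) (l : Fin n) :
    ∫ w, (pol.count μ η l w : ℝ) = pol.T * pol.frac μ l η := by
  have hT : (pol.T : ℝ) ≠ 0 := by exact_mod_cast pol.T_pos.ne'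
  rw [frac, integral_div]
  field_simp

lemma shift_zero (a ε : ℝ) (η : Equiv.Perm (Fin n)) (w : I) (l : Fin n) :
    pol.shift μ a ε (pol.Y η μ w) 0 (η l) = a * pol.count μ η l w - pol.T * μ (η l) := by
  simp [shift, remaining, count]

lemma abs_sum_scaled_mul_shift_le {a ε K : ℝ}
    (hK : ∀ d (j : Fin pol.T) l, |pol.shift μ a ε d j l| ≤ K) (q : Fin n → ℕ)
    (d : Fin pol.T → Fin n) :
    ‖∑ l, (pol.scaled q l : ℝ) * pol.shift μ a ε d 0 l‖ ≤ ∑ l, (pol.scaled q l : ℝ) * K := by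
  refine (norm_sum_le _ _).trans (Finset.sum_le_sum fun l _ => ?_)
  rw [norm_mul, Real.norm_of_nonneg (NNReal.coe_nonneg _)]
  exact mul_le_mul_of_nonneg_left (hK d ⟨0, pol.T_pos⟩ l) (NNReal.coe_nonneg _)

lemma integrable_sum_scaled_mul_shift (a ε : ℝ) (q : Fin n → ℕ) :
    Integrable (fun p : I × I =>
      ∑ l, (pol.scaled q l : ℝ) * pol.shift μ a ε (pol.decision μ q p.1 p.2) 0 l)
      ((volume : Measure I).prod (volume : Measure I)) := by
  obtain ⟨K, -, hK⟩ := pol.exists_shift_bound μ a ε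
  refine Integrable.of_bound ?_ _
    (ae_of_all _ fun p => pol.abs_sum_scaled_mul_shift_le μ hK q (pol.decision μ q p.1 p.2))
  exact ((Measurable.of_discrete (f := fun d : Fin pol.T → Fin n =>
    ∑ l, (pol.scaled q l : ℝ) * pol.shift μ a ε d 0 l)).comp
      (pol.measurable_decision μ q)).aestronglyMeasurable

/-- At the start of a cycle, the expected change in the direction of the scaled queue lengths is
negative. -/
lemma integral_sum_scaled_mul_shift_le {a δ : ℝ} (hδ : 0 ≤ δ)
    (hstab : ∀ η m, ∑ l ∈ Finset.Iic m, (a * pol.frac μ l η - μ (η l)) ≤ -δ) (q : Fin n → ℕ) :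
    ∫ p : I × I, ∑ l, (pol.scaled q l : ℝ) *
        pol.shift μ a (δ / n) (pol.decision μ q p.1 p.2) 0 l
        ∂((volume : Measure I).prod (volume : Measure I)) ≤
      -(δ / n * pol.T) * ∑ l, (pol.scaled q l : ℝ) := by
  -- Fixing the sorting seed fixes the permutation; the decision seed is then averaged out, with a
  -- bound uniform in the sorting seed.
  have h := integral_prod_le (ν := (volume : Measure I)) (ρ := (volume : Measure I))
    (pol.integrable_sum_scaled_mul_shift μ a (δ / n) q)
    (g := fun _ => -(δ / n * pol.T) * ∑ l, (pol.scaled q l : ℝ)) (integrable_const _)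
    (ae_of_all _ fun v => ?_)
  · simpa using h
  · set η := pol.L (pol.scaled q) v with hη
    have h1 : ∀ w : I, ∑ l, (pol.scaled q l : ℝ) *
        pol.shift μ a (δ / n) (pol.decision μ q v w) 0 l =
        ∑ l, (pol.scaled q (η l) : ℝ) * (a * pol.count μ η l w - pol.T * μ (η l)) := by
      intro w
      -- Summing by rank makes the scaled lengths antitone, as summation by parts requires.
      rw [← Equiv.sum_comp η]
      refine Finset.sum_congr rfl fun l _ => ?_
      rw [← pol.shift_zero μ a (δ / n)]
      rfl
    have hint : ∀ l, Integrable fun w : I => a * pol.count μ η l w - pol.T * μ (η l) :=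
      fun l => ((pol.integrable_count μ η l).const_mul a).sub (integrable_const _)
    have h2 : ∫ w : I, ∑ l, (pol.scaled q (η l) : ℝ) *
        (a * pol.count μ η l w - pol.T * μ (η l)) =
        pol.T * ∑ l, (pol.scaled q (η l) : ℝ) * (a * pol.frac μ l η - μ (η l)) := by
      rw [integral_finsetSum _ fun l _ => (hint l).const_mul _, Finset.mul_sum]
      refine Finset.sum_congr rfl fun l _ => ?_
      rw [integral_const_mul, integral_sub ((pol.integrable_count μ η l).const_mul a)
        (integrable_const _), integral_const_mul, pol.integral_count]
      simp
      ring
    have h3 := sum_mul_le_neg_sum hδ (o := fun l => (pol.scaled q (η l) : ℝ))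
      (fun i j hij => NNReal.coe_le_coe.2 (pol.L_sorted (pol.scaled q) v hij))
      (fun l => NNReal.coe_nonneg _) (hstab η)
    rw [Equiv.sum_comp η fun l => (pol.scaled q l : ℝ)] at h3
    simp only [h1]
    rw [h2]
    calc _ ≤ (pol.T : ℝ) * (-(δ / n) * ∑ l, (pol.scaled q l : ℝ)) := by gcongr
      _ = _ := by ring

/-- The difference of arrivals and potential services at the `l`-th queue, when the arrivals are
sent to queue `i`. -/
def increment (i : Fin n) (p : ℕ × (Fin n → ℕ)) (l : Fin n) : ℝ :=
  (if l = i then (p.1 : ℝ) else 0) - p.2 l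

lemma add_increment_le_nextQueue (q : Fin n → ℕ) (i : Fin n) (p : ℕ × (Fin n → ℕ)) (l : Fin n) :
    (q l : ℝ) + increment i p l ≤ nextQueue q i p.1 p.2 l := by
  have h : q l + (if l = i then p.1 else 0) ≤ nextQueue q i p.1 p.2 l + p.2 l := by
    unfold nextQueue; omega
  have h' : ((q l + (if l = i then p.1 else 0) : ℕ) : ℝ) ≤
      (nextQueue q i p.1 p.2 l + p.2 l : ℕ) := by exact_mod_cast h
  push_cast at h'
  unfold increment
  linarith

lemma nextQueue_eq_max (q : Fin n → ℕ) (i : Fin n) (p : ℕ × (Fin n → ℕ)) (l : Fin n) :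
    (nextQueue q i p.1 p.2 l : ℝ) = max (q l + increment i p l) 0 := by
  refine le_antisymm ?_ (max_le (add_increment_le_nextQueue q i p l) (Nat.cast_nonneg _))
  rcases le_total (p.2 l) (q l + (if l = i then p.1 else 0)) with h | h
  · refine le_max_of_le_left (le_of_eq ?_)
    unfold nextQueue increment
    rw [Nat.cast_sub h]
    push_cast
    ring
  · refine le_max_of_le_right (le_of_eq ?_)
    unfold nextQueue
    rw [Nat.sub_eq_zero_of_le h, Nat.cast_zero]

lemma abs_increment_le {M : ℝ} {p : ℕ × (Fin n → ℕ)} (hp : (p.1 : ℝ) ≤ M ∧ ∀ l, (p.2 l : ℝ) ≤ M)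
    (i l : Fin n) : |increment i p l| ≤ M := by
  have h1 : (0 : ℝ) ≤ p.1 := Nat.cast_nonneg _
  have h2 : (0 : ℝ) ≤ p.2 l := Nat.cast_nonneg _
  have h3 := hp.1
  have h4 := hp.2 l
  unfold increment
  rw [abs_le]
  split_ifs <;> constructor <;> linarith

lemma nextQueue_le {M : ℝ} {p : ℕ × (Fin n → ℕ)} (hp : (p.1 : ℝ) ≤ M ∧ ∀ l, (p.2 l : ℝ) ≤ M)
    (q : Fin n → ℕ) (i l : Fin n) : (nextQueue q i p.1 p.2 l : ℝ) ≤ q l + M := by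
  have h := abs_le.1 (abs_increment_le hp i l)
  have h0 : (0 : ℝ) ≤ q l := Nat.cast_nonneg _
  rw [nextQueue_eq_max]
  exact max_le (by linarith) (by linarith)

/-- Truncation at 0 can only decrease the square, so the cross term may use the untruncated
increment. -/
lemma sq_nextQueue_le {M : ℝ} {p : ℕ × (Fin n → ℕ)}
    (hp : (p.1 : ℝ) ≤ M ∧ ∀ l, (p.2 l : ℝ) ≤ M) (q : Fin n → ℕ) (i l : Fin n) :
    (nextQueue q i p.1 p.2 l : ℝ) ^ 2 ≤ q l ^ 2 + 2 * q l * increment i p l + M ^ 2 := by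
  have h := abs_increment_le hp i l
  have h1 : increment i p l ^ 2 ≤ M ^ 2 := sq_le_sq' (abs_le.1 h).1 (abs_le.1 h).2
  rw [nextQueue_eq_max]
  have h2 : max ((q l : ℝ) + increment i p l) 0 ^ 2 ≤ ((q l : ℝ) + increment i p l) ^ 2 := by
    rcases le_total ((q l : ℝ) + increment i p l) 0 with h | h
    · rw [max_eq_right h, zero_pow two_ne_zero]; exact sq_nonneg _
    · rw [max_eq_left h]
  nlinarith

lemma gamma_pos (l : Fin n) : (0 : ℝ) < pol.γ l := NNReal.coe_pos.2 (pol.γ_pos l)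

lemma step_fst (x : pol.State) (u : (ℕ × (Fin n → ℕ)) × (I × I)) :
    (pol.step μ x u).1 = nextQueue x.1 (x.2.1 x.2.2) u.1.1 u.1.2 := by
  unfold step
  split_ifs <;> rfl

lemma lyapunov_step_le {a ε K M : ℝ} (hK : ∀ d (j : Fin pol.T) l, |pol.shift μ a ε d j l| ≤ K)
    (x : pol.State) {p : ℕ × (Fin n → ℕ)} (hp : (p.1 : ℝ) ≤ M ∧ ∀ l, (p.2 l : ℝ) ≤ M)
    (vw : I × I) :
    ‖pol.lyapunov μ a ε (pol.step μ x (p, vw))‖ ≤ ∑ l, ((x.1 l : ℝ) + M + K) ^ 2 / pol.γ l := by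
  rw [Real.norm_of_nonneg (pol.lyapunov_nonneg μ a ε _)]
  refine Finset.sum_le_sum fun l _ => ?_
  have h1 := nextQueue_le hp x.1 (x.2.1 x.2.2) l
  have h2 := abs_le.1 (hK (pol.step μ x (p, vw)).2.1 (pol.step μ x (p, vw)).2.2 l)
  have h3 : (0 : ℝ) ≤ nextQueue x.1 (x.2.1 x.2.2) p.1 p.2 l := Nat.cast_nonneg _
  have h4 : (0 : ℝ) ≤ x.1 l := Nat.cast_nonneg _
  have h5 : 0 ≤ M := (Nat.cast_nonneg _).trans hp.1
  rw [pol.step_fst]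
  have := pol.gamma_pos l
  gcongr ?_ / _
  exact sq_le_sq' (by linarith) (by linarith)

lemma measurable_lyapunov_step (a ε : ℝ) (x : pol.State) :
    Measurable fun u => pol.lyapunov μ a ε (pol.step μ x u) :=
  (Measurable.of_discrete (f := pol.lyapunov μ a ε)).comp (pol.measurable_step μ x)

/-- The conditional drift of the Lyapunov function, given the arrivals and the services. -/
lemma integral_lyapunov_step_le {a δ K M : ℝ} (hδ : 0 ≤ δ)
    (hstab : ∀ η m, ∑ l ∈ Finset.Iic m, (a * pol.frac μ l η - μ (η l)) ≤ -δ) (hK0 : 0 ≤ K)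
    (hK : ∀ d (j : Fin pol.T) l, |pol.shift μ a (δ / n) d j l| ≤ K)
    (x : pol.State) {p : ℕ × (Fin n → ℕ)} (hp : (p.1 : ℝ) ≤ M ∧ ∀ l, (p.2 l : ℝ) ≤ M) :
    ∫ vw, pol.lyapunov μ a (δ / n) (pol.step μ x (p, vw))
        ∂((volume : Measure I).prod (volume : Measure I)) ≤
      ∑ l, ((x.1 l : ℝ) ^ 2 + 2 * x.1 l * (increment (x.2.1 x.2.2) p l +
        pol.shift μ a (δ / n) x.2.1 (x.2.2 + 1 : ℕ) l) +
        (M ^ 2 + 2 * M * K + K ^ 2 + 2 * (δ / n) * pol.T * M)) / pol.γ l := by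
  set ε := δ / n with hε
  have hε0 : 0 ≤ ε := by positivity
  have hM0 : 0 ≤ M := (Nat.cast_nonneg _).trans hp.1
  have hTr : (0 : ℝ) ≤ pol.T := Nat.cast_nonneg _
  obtain ⟨q, d, j⟩ := x
  by_cases hj : (j : ℕ) + 1 < pol.T
  · simp only [pol.step_of_lt μ (q, d, j) _ hj, integral_const, probReal_univ, one_smul]
    refine Finset.sum_le_sum fun l _ => ?_
    have hγ := pol.gamma_pos l
    gcongr ?_ / _
    have h1 := sq_nextQueue_le hp q (d j) l
    have h2 := abs_le.1 (hK d ⟨j + 1, hj⟩ l)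
    have h3 := abs_le.1 (abs_increment_le hp (d j) l)
    have h4 := nextQueue_le hp q (d j) l
    have h5 := add_increment_le_nextQueue q (d j) p l
    simp only at h1 h2 h4 h5 ⊢
    set c := pol.shift μ a ε d (j + 1) l
    set q' : ℝ := ((nextQueue q (d j) p.1 p.2 l : ℕ) : ℝ)
    -- A queue moves by at most M in one slot, so replacing the new length by the old one in the
    -- cross term costs a constant.
    have h6 : (q' - q l) * c ≤ M * K := by
      refine (le_abs_self _).trans ?_
      rw [abs_mul]
      exact mul_le_mul (abs_le.2 ⟨by linarith, by linarith⟩) (abs_le.2 h2) (abs_nonneg _) hM0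
    have h7 : c ^ 2 ≤ K ^ 2 := sq_le_sq' h2.1 h2.2
    have h8 : 0 ≤ ε * pol.T * M := by positivity
    nlinarith
  · have hj' : (j : ℕ) + 1 = pol.T := by have := j.2; omega
    set q' : Fin n → ℕ := nextQueue q (d j) p.1 p.2 with hq'
    have hcoe : ∀ l, (pol.scaled q' l : ℝ) = (q' l : ℝ) / pol.γ l := pol.coe_scaled q'
    have hpt : ∀ vw : I × I, pol.lyapunov μ a ε (pol.step μ (q, d, j) (p, vw)) ≤
        ∑ l, ((q l : ℝ) ^ 2 + 2 * q l * increment (d j) p l + M ^ 2 + K ^ 2) / pol.γ l +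
        2 * ∑ l, (pol.scaled q' l : ℝ) *
          pol.shift μ a ε (pol.decision μ q' vw.1 vw.2) 0 l := by
      intro vw
      rw [pol.step_of_not_lt μ (q, d, j) _ hj, Finset.mul_sum, ← Finset.sum_add_distrib]
      refine Finset.sum_le_sum fun l _ => ?_
      have hγ := pol.gamma_pos l
      have h1 := sq_nextQueue_le hp q (d j) l
      have h2 := abs_le.1 (hK (pol.decision μ q' vw.1 vw.2) ⟨0, pol.T_pos⟩ l)
      simp only [← hq'] at h1 h2 ⊢
      set c := pol.shift μ a ε (pol.decision μ q' vw.1 vw.2) 0 l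
      have h7 : c ^ 2 ≤ K ^ 2 := sq_le_sq' h2.1 h2.2
      rw [hcoe]
      calc ((q' l : ℝ) + c) ^ 2 / pol.γ l
          ≤ ((q l : ℝ) ^ 2 + 2 * q l * increment (d j) p l + M ^ 2 + K ^ 2 + 2 * q' l * c) /
            pol.γ l := by
              gcongr ?_ / _
              linarith
        _ = _ := by ring
    have hint : Integrable (fun vw => pol.lyapunov μ a ε (pol.step μ (q, d, j) (p, vw)))
        ((volume : Measure I).prod (volume : Measure I)) := by
      refine Integrable.of_bound ?_ _ (ae_of_all _ (pol.lyapunov_step_le μ hK (q, d, j) hp))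
      exact ((pol.measurable_lyapunov_step μ a ε (q, d, j)).comp
        measurable_prodMk_left).aestronglyMeasurable
    have hint2 := (pol.integrable_sum_scaled_mul_shift μ a ε q').const_mul 2
    refine (integral_mono hint ((integrable_const _).add hint2) hpt).trans ?_
    rw [integral_add' (integrable_const _) hint2, integral_const_mul]
    simp only [integral_const, probReal_univ, one_smul]
    -- Averaging the new cycle's shift over the seeds yields the coefficient -εT, equal to the old
    -- shift at position T. Both cases thus have the same bound.
    have hdrift := pol.integral_sum_scaled_mul_shift_le μ hδ hstab q'
    rw [← hε] at hdrift
    refine (add_le_add le_rfl (mul_le_mul_of_nonneg_left hdrift zero_le_two)).trans ?_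
    rw [Finset.mul_sum, Finset.mul_sum, ← Finset.sum_add_distrib]
    refine Finset.sum_le_sum fun l _ => ?_
    have hγ := pol.gamma_pos l
    rw [hcoe, hj', pol.shift_T]
    have h3 := abs_le.1 (abs_increment_le hp (d j) l)
    have h5 := add_increment_le_nextQueue q (d j) p l
    rw [← hq'] at h5
    -- Passing from the new length back to the old one produces the term 2εTM of the constant.
    have h9 : ε * pol.T * (q l - M) ≤ ε * pol.T * q' l := by
      gcongr
      linarith
    have h10 : 0 ≤ M * K := by positivity
    calc ((q l : ℝ) ^ 2 + 2 * q l * increment (d j) p l + M ^ 2 + K ^ 2) / pol.γ l +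
          2 * (-(ε * pol.T) * ((q' l : ℝ) / pol.γ l))
        = ((q l : ℝ) ^ 2 + 2 * q l * increment (d j) p l + M ^ 2 + K ^ 2
            - 2 * (ε * pol.T * q' l)) / pol.γ l := by ring
      _ ≤ _ := by
        gcongr ?_ / _
        nlinarith

section Drift

variable {α : Measure ℕ} [IsProbabilityMeasure α] {ς : Measure (Fin n → ℕ)}
  [IsProbabilityMeasure ς] {a M : ℝ}

lemma integrable_increment (hα_bdd : ∀ᵐ k ∂α, ((k : ℕ) : ℝ) ≤ M)
    (hς_bdd : ∀ l, ∀ᵐ s ∂ς, (s l : ℝ) ≤ M) (i l : Fin n) :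
    Integrable (fun p => increment i p l) (α.prod ς) ∧
      ∫ p, increment i p l ∂(α.prod ς) =
        (if l = i then ∫ k, (k : ℝ) ∂α else 0) - ∫ s, (s l : ℝ) ∂ς := by
  have h1 : Integrable (fun k : ℕ => (k : ℝ)) α :=
    Integrable.of_bound Measurable.of_discrete.aestronglyMeasurable M
      (hα_bdd.mono fun k hk => by rwa [Real.norm_natCast])
  have h2 : Integrable (fun s : Fin n → ℕ => (s l : ℝ)) ς :=
    Integrable.of_bound Measurable.of_discrete.aestronglyMeasurable M
      ((hς_bdd l).mono fun s hs => by rwa [Real.norm_natCast])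
  have h1' : Integrable (fun p : ℕ × (Fin n → ℕ) => (p.1 : ℝ)) (α.prod ς) := h1.comp_fst ς
  have h2' : Integrable (fun p : ℕ × (Fin n → ℕ) => (p.2 l : ℝ)) (α.prod ς) := h2.comp_snd α
  have h4 : ∫ p : ℕ × (Fin n → ℕ), (p.2 l : ℝ) ∂(α.prod ς) = ∫ s, (s l : ℝ) ∂ς := by
    rw [integral_fun_snd (μ := α) (ν := ς) fun s : Fin n → ℕ => (s l : ℝ)]
    simp
  have h3 : ∫ p : ℕ × (Fin n → ℕ), (p.1 : ℝ) ∂(α.prod ς) = ∫ k, (k : ℝ) ∂α := by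
    rw [integral_fun_fst (μ := α) (ν := ς) fun k : ℕ => (k : ℝ)]
    simp
  unfold increment
  split_ifs with h
  · exact ⟨h1'.sub h2', by rw [integral_sub h1' h2', h3, h4]⟩
  · exact ⟨(integrable_const 0).sub h2', by
      rw [integral_sub (integrable_const 0) h2', h4]; simp⟩

/-- The drift of the Lyapunov function. -/
lemma lyapunov_drift {δ : ℝ} (hδ : 0 ≤ δ) (hα_mean : ∫ k, (k : ℝ) ∂α = a)
    (hα_bdd : ∀ᵐ k ∂α, ((k : ℕ) : ℝ) ≤ M)
    (hς_mean : ∀ l, ∫ s, (s l : ℝ) ∂ς = (μ l : ℝ))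
    (hς_bdd : ∀ l, ∀ᵐ s ∂ς, (s l : ℝ) ≤ M)
    (hstab : ∀ η m, ∑ l ∈ Finset.Iic m, (a * pol.frac μ l η - μ (η l)) ≤ -δ) :
    ∃ C : ℝ, ∀ x : pol.State,
      Integrable (pol.lyapunov μ a (δ / n)) (pol.chainKernel μ α ς x) ∧
      ∫ y, pol.lyapunov μ a (δ / n) y ∂(pol.chainKernel μ α ς x) ≤
        pol.lyapunov μ a (δ / n) x + C - 2 * (δ / n) * ∑ l, (pol.scaled x.1 l : ℝ) := by
  obtain ⟨K, hK0, hK⟩ := pol.exists_shift_bound μ a (δ / n)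
  set D := M ^ 2 + 2 * M * K + K ^ 2 + 2 * (δ / n) * pol.T * M with hD
  refine ⟨∑ l, D / pol.γ l, fun x => ?_⟩
  have hgood : ∀ᵐ p ∂(α.prod ς), (p.1 : ℝ) ≤ M ∧ ∀ l, (p.2 l : ℝ) ≤ M :=
    (Measure.quasiMeasurePreserving_fst.ae hα_bdd).and
      (Measure.quasiMeasurePreserving_snd.ae (ae_all_iff.2 hς_bdd))
  have hker : pol.chainKernel μ α ς x =
      ((α.prod ς).prod ((volume : Measure I).prod (volume : Measure I))).map (pol.step μ x) := rfl
  have hint : Integrable (fun u => pol.lyapunov μ a (δ / n) (pol.step μ x u))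
      ((α.prod ς).prod ((volume : Measure I).prod (volume : Measure I))) := by
    refine Integrable.of_bound (pol.measurable_lyapunov_step μ a _ x).aestronglyMeasurable _
      ((Measure.quasiMeasurePreserving_fst.ae hgood).mono fun u hu =>
        pol.lyapunov_step_le μ hK x hu u.2)
  have hmeas : AEStronglyMeasurable (pol.lyapunov μ a (δ / n)) (((α.prod ς).prod
      ((volume : Measure I).prod (volume : Measure I))).map (pol.step μ x)) :=
    (Measurable.of_discrete (f := pol.lyapunov μ a (δ / n))).aestronglyMeasurable
  rw [hker, integrable_map_measure hmeas (pol.measurable_step μ x).aemeasurable,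
    integral_map (pol.measurable_step μ x).aemeasurable hmeas]
  refine ⟨hint, ?_⟩
  have hterm : ∀ l, Integrable (fun p => ((x.1 l : ℝ) ^ 2 + 2 * x.1 l *
      (increment (x.2.1 x.2.2) p l + pol.shift μ a (δ / n) x.2.1 (x.2.2 + 1 : ℕ) l) + D) /
        pol.γ l) (α.prod ς) := fun l =>
    ((((integrable_const _).add ((((integrable_increment hα_bdd hς_bdd (x.2.1 x.2.2) l).1).add
      (integrable_const _)).const_mul _)).add (integrable_const _)).div_const _)
  refine (integral_prod_le hint (integrable_finsetSum _ fun l _ => hterm l)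
    (hgood.mono fun p hp => pol.integral_lyapunov_step_le μ hδ hstab hK0 hK x hp)).trans ?_
  rw [integral_finsetSum _ fun l _ => hterm l, lyapunov, Finset.mul_sum,
    ← Finset.sum_add_distrib, ← Finset.sum_sub_distrib]
  refine Finset.sum_le_sum fun l _ => ?_
  have hγ := pol.gamma_pos l
  obtain ⟨hi, hie⟩ := integrable_increment (α := α) (ς := ς) hα_bdd hς_bdd (x.2.1 x.2.2) l
  have hval : ∫ p, ((x.1 l : ℝ) ^ 2 + 2 * x.1 l *
      (increment (x.2.1 x.2.2) p l + pol.shift μ a (δ / n) x.2.1 (x.2.2 + 1 : ℕ) l) + D) /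
        pol.γ l ∂(α.prod ς) = ((x.1 l : ℝ) ^ 2 + 2 * x.1 l *
      (((if l = x.2.1 x.2.2 then a else 0) - μ l) +
        pol.shift μ a (δ / n) x.2.1 (x.2.2 + 1 : ℕ) l) + D) / pol.γ l := by
    have hi2 : Integrable (fun p => increment (x.2.1 x.2.2) p l +
        pol.shift μ a (δ / n) x.2.1 (x.2.2 + 1 : ℕ) l) (α.prod ς) :=
      hi.add (integrable_const _)
    have hi3 : Integrable (fun p => (x.1 l : ℝ) ^ 2 + 2 * x.1 l * (increment (x.2.1 x.2.2) p l +
        pol.shift μ a (δ / n) x.2.1 (x.2.2 + 1 : ℕ) l)) (α.prod ς) :=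
      (integrable_const _).add (hi2.const_mul _)
    rw [integral_div, integral_add hi3 (integrable_const _), integral_add (integrable_const _) (hi2.const_mul _),
      integral_const_mul, integral_add hi (integrable_const _), hie, hα_mean, hς_mean]
    simp
  rw [hval, pol.shift_eq_add μ a (δ / n) x.2.1 x.2.2 l, pol.coe_scaled]
  set c := pol.shift μ a (δ / n) x.2.1 (x.2.2 + 1 : ℕ) l
  set b : ℝ := if l = x.2.1 x.2.2 then a else 0
  rw [← add_div, mul_div_assoc', ← sub_div]
  gcongr ?_ / _
  -- The current shift is s = c + b - μ_l + ε, and (q + s)² - 2εq exceeds q² + 2q (b - μ_l + c) by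
  -- exactly s².
  nlinarith [sq_nonneg (c + b - μ l + δ / n)]

end Drift

end Policy

/-! ### From the stability condition to positive recurrence. -/

lemma exists_pos_forall_le {ι : Type*} [Finite ι] (f : ι → ℝ) (hf : ∀ i, 0 < f i) :
    ∃ δ > 0, ∀ i, δ ≤ f i := by
  cases isEmpty_or_nonempty ι
  · exact ⟨1, one_pos, fun i => isEmptyElim i⟩
  · obtain ⟨i, hi⟩ := Finite.exists_min f
    exact ⟨f i, hf i, hi⟩

namespace Policy

variable {n : ℕ} (pol : Policy n) (μ : Fin n → {r : ℝ // 0 < r})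

/-- A decision vector has at least one entry, and that entry names a server. Positivity of n is
needed for δ/n > 0. -/
lemma pos_of_policy {n : ℕ} (pol : Policy n) : 0 < n :=
  (pol.Y 1 (fun _ => ⟨1, one_pos⟩) 0 ⟨0, pol.T_pos⟩).pos

/-- The stability condition in terms of partial sums of the drifts. -/
lemma exists_partialSums_le {a : ℝ} (ha : 0 ≤ a)
    (hstab : ENNReal.ofReal a <
      ⨅ (η : Equiv.Perm (Fin n)) (m : Fin n),
        (∑ l ∈ Finset.Iic m, ENNReal.ofReal (μ (η l) : ℝ)) /
          (∑ l ∈ Finset.Iic m, ENNReal.ofReal (pol.frac μ l η))) :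
    ∃ δ > 0, ∀ η m, ∑ l ∈ Finset.Iic m, (a * pol.frac μ l η - μ (η l)) ≤ -δ := by
  obtain ⟨δ, hδ, h⟩ := exists_pos_forall_le
    (fun p : Equiv.Perm (Fin n) × Fin n =>
      -∑ l ∈ Finset.Iic p.2, (a * pol.frac μ l p.1 - μ (p.1 l))) (fun p => by
    -- Clearing the denominator in `ℝ≥0∞` also covers a zero denominator.
    have h1 := ENNReal.mul_lt_of_lt_div (hstab.trans_le (iInf₂_le p.1 p.2))
    rw [← ENNReal.ofReal_sum_of_nonneg fun l _ => pol.frac_nonneg μ l p.1,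
      ← ENNReal.ofReal_sum_of_nonneg fun l _ => (μ (p.1 l)).2.le, ← ENNReal.ofReal_mul ha,
      ENNReal.ofReal_lt_ofReal_iff_of_nonneg
        (mul_nonneg ha (Finset.sum_nonneg fun l _ => pol.frac_nonneg μ l p.1))] at h1
    rw [Finset.sum_sub_distrib, ← Finset.mul_sum]
    linarith)
  exact ⟨δ, hδ, fun η m => by have := h (η, m); simp only at this; linarith⟩

/-- Bounded queues leave finitely many states, since decision vectors and positions range over
finite sets. This is the exceptional set of the Foster–Lyapunov criterion. -/
lemma finite_sum_scaled_lt (R : ℝ) :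
    {x : pol.State | ∑ l, (pol.scaled x.1 l : ℝ) < R}.Finite := by
  obtain ⟨N, hN⟩ : ∃ N : Fin n → ℕ, ∀ l, R * pol.γ l ≤ N l :=
    ⟨fun l => ⌈R * pol.γ l⌉₊, fun l => Nat.le_ceil _⟩
  refine ((Set.finite_Iic N).prod Set.finite_univ).subset fun x hx => ⟨fun l => ?_, trivial⟩
  have h1 : (pol.scaled x.1 l : ℝ) ≤ ∑ l, (pol.scaled x.1 l : ℝ) :=
    Finset.single_le_sum (f := fun l => (pol.scaled x.1 l : ℝ))
      (fun l _ => NNReal.coe_nonneg _) (Finset.mem_univ l)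
  have h2 : (x.1 l : ℝ) / pol.γ l < R := by
    rw [← pol.coe_scaled]
    exact h1.trans_lt hx
  rw [div_lt_iff₀ (pol.gamma_pos l)] at h2
  exact_mod_cast (h2.le.trans (hN l))

theorem positiveRecurrent_chainKernel {α : Measure ℕ} [IsProbabilityMeasure α]
    {ς : Measure (Fin n → ℕ)} [IsProbabilityMeasure ς] {a M : ℝ}
    (hα_mean : ∫ k, (k : ℝ) ∂α = a) (hα_bdd : ∀ᵐ k ∂α, ((k : ℕ) : ℝ) ≤ M)
    (hς_mean : ∀ l, ∫ s, (s l : ℝ) ∂ς = (μ l : ℝ))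
    (hς_bdd : ∀ l, ∀ᵐ s ∂ς, (s l : ℝ) ≤ M)
    (hstab : ENNReal.ofReal a <
      ⨅ (η : Equiv.Perm (Fin n)) (m : Fin n),
        (∑ l ∈ Finset.Iic m, ENNReal.ofReal (μ (η l) : ℝ)) /
          (∑ l ∈ Finset.Iic m, ENNReal.ofReal (pol.frac μ l η))) :
    PositiveRecurrent (pol.chainKernel μ α ς) := by
  have ha : 0 ≤ a := hα_mean ▸ integral_nonneg fun k => Nat.cast_nonneg k
  obtain ⟨δ, hδ, hpart⟩ := pol.exists_partialSums_le μ ha hstab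
  obtain ⟨C, hC⟩ := pol.lyapunov_drift μ hδ.le hα_mean hα_bdd hς_mean hς_bdd hpart
  have hn : (0 : ℝ) < n := Nat.cast_pos.2 pol.pos_of_policy
  set ε := δ / n
  have hε : 0 < ε := div_pos hδ hn
  have hlint : ∀ x, ∫⁻ y, ENNReal.ofReal (pol.lyapunov μ a ε y) ∂(pol.chainKernel μ α ς x) =
      ENNReal.ofReal (∫ y, pol.lyapunov μ a ε y ∂(pol.chainKernel μ α ς x)) := fun x =>
    (ofReal_integral_eq_lintegral_ofReal (hC x).1
      (ae_of_all _ fun y => pol.lyapunov_nonneg μ a ε y)).symm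
  refine positiveRecurrent_of_drift (pol.chainKernel μ α ς)
    (v := fun x => ENNReal.ofReal (pol.lyapunov μ a ε x))
    -- Beyond this radius the drift bound C - 2ε Σ Q_l / γ_l is at most -1.
    (pol.finite_sum_scaled_lt ((C + 1) / (2 * ε))) (fun x => ENNReal.ofReal_lt_top)
    (fun x hx => ?_) (fun x => by rw [hlint]; exact ENNReal.ofReal_lt_top)
  rw [hlint, ← ENNReal.ofReal_one, ← ENNReal.ofReal_add
    (integral_nonneg fun y => pol.lyapunov_nonneg μ a ε y) zero_le_one]
  refine ENNReal.ofReal_le_ofReal ?_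
  have h1 := (hC x).2
  have h2 : (C + 1) / (2 * ε) ≤ ∑ l, (pol.scaled x.1 l : ℝ) := not_lt.1 hx
  rw [div_le_iff₀ (by positivity)] at h2
  linarith

end Policy

end LoadBalancing

theorem theorem1 {n : ℕ} (pol : LoadBalancing.Policy n) (lam Amax Smax : ℝ)
    (μ : Fin n → {r : ℝ // 0 < r})
    (α : Measure ℕ) [IsProbabilityMeasure α]
    (ς : Measure (Fin n → ℕ)) [IsProbabilityMeasure ς]
    (hα_mean : ∫ a, (a : ℝ) ∂α = n * lam)
    (hα_bdd : ∀ᵐ a ∂α, ((a : ℕ) : ℝ) ≤ n * Amax)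
    (hς_mean : ∀ l, ∫ s, (s l : ℝ) ∂ς = (μ l : ℝ))
    (hς_bdd : ∀ l, ∀ᵐ s ∂ς, (s l : ℝ) ≤ Smax)
    (hstab : ENNReal.ofReal (n * lam) <
      ⨅ (η : Equiv.Perm (Fin n)) (m : Fin n),
        (∑ l ∈ Finset.Iic m, ENNReal.ofReal (μ (η l) : ℝ)) /
          (∑ l ∈ Finset.Iic m, ENNReal.ofReal (pol.frac μ l η)))
    {Ω : Type*} [MeasurableSpace Ω] (P : Measure Ω) [IsProbabilityMeasure P]
    (A : ℕ → Ω → ℕ) (S : ℕ → Ω → Fin n → ℕ) (V W : ℕ → Ω → I) (Q : ℕ → Ω → Fin n → ℕ)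
    (hQ : LoadBalancing.IsQueueingSystem P pol μ α ς A S V W Q) :
    LoadBalancing.IsMarkovChain P (LoadBalancing.chain pol μ Q V W) (pol.chainKernel μ α ς) ∧
      LoadBalancing.PositiveRecurrent (pol.chainKernel μ α ς) := by
  refine ⟨hQ.isMarkovChain, pol.positiveRecurrent_chainKernel μ (M := max (n * Amax) Smax)
    hα_mean (hα_bdd.mono fun k hk => hk.trans (le_max_left _ _)) hς_mean
    (fun l => (hς_bdd l).mono fun s hs => hs.trans (le_max_right _ _)) hstab⟩
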